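/- Let $G$ be any connected graph and let $U\subseteq V(G)$ be any vertex set. Then exactly one of the following two assertions holds: (i) $G$ contains a star attached to $U$, that is, a subdivision of an infinite star all of whose leaves lie in $U$; (ii) $G$ has a locally finite tree-decomposition (one whose decomposition tree is locally finite) such that the separators at the edges of the tree (the intersections of the two parts at the ends of an edge) are finite, the separators at any two distinct edges are disjoint, and each part contains at most finitely many vertices of $U$. Moreover, if (ii) holds, then $\partial_\Gamma U$ consists only of ends, and the tree-decomposition in (ii) can be chosen so that all its separators induce connected (non-empty) subgraphs of $G$ and so that, for a suitable choice of a root of its tree, it is tame and displays $\partial_\Gamma U$. Here the following definitions are used. *Remainder and closure.* An end of $G$ is an equivalence class of rays (one-way infinite paths), two rays being equivalent if for every finite $X\subseteq V(G)$ both have a tail in the same component of $G-X$; for an end $\omega$, write $C(X,\omega)$ for the component of $G-X$ in which all rays of $\omega$ have a tail. A finite set $X\subseteq V(G)$ is critical if the set $\breve{\mathcal C}_X$ of the components $C$ of $G-X$ with neighbourhood $N(C)=X$ is infinite. Let $\Gamma(G)$ be the disjoint union of the set of ends of $G$ and the set of critical vertex sets of $G$. Then $\partial_\Gamma U\subseteq\Gamma(G)$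 consists of the ends $\omega$ such that $C(X,\omega)$ meets $U$ for every finite $X\subseteq V(G)$, and of the critical vertex sets $X$ such that infinitely many components in $\breve{\mathcal C}_X$ meet $U$. *Tame.* For a set $X$ of vertices and a set $\mathcal C$ of components of $G-X$, let $V[\mathcal C]$ be the union of their vertex sets, and let $(X,\mathcal C)$ be the oriented separation $(V(G)\setminus V[\mathcal C],\,X\cup V[\mathcal C])$ and $(\mathcal C,X)$ its inverse; write $(C,X)$ for $(\{C\},X)$. A separation $\{A,B\}$ with finite separator $X=A\cap B$, written as $\{X,\mathcal C\}$, is tame if for no $Y\subseteq X$ both $\mathcal C$ and its complement in the set of components of $G-X$ contain infinitely many components with neighbourhood exactly $Y$. For adjacent nodes $s,t$ of the decomposition tree $T$, let $\alpha(s,t)=(A,B)$, where $A$ and $B$ are the unions of the parts at the nodes in the component of $T-st$ containing $s$ and $t$, respectively. The tree-decomposition is tame if all these separations are tame. *Display.* An end of $G$ orients the edge $st$ towards $t$ if each of its rays has a tail in $B$; a critical vertex set $X$ does so if $B$ contains $X$ and all but finitely many of the components in $\breve{\mathcal C}_X$. In a tame tree-decomposition every $\gamma\in\Gamma(G)$ orients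 each edge of $T$ in exactly one way; let $\sigma(\gamma)$ be the unique node $t$ of $T$ such that all edges at $t$ are oriented towards $t$, if there is one, and otherwise the unique end of $T$ containing a ray all of whose edges are oriented forwards. A rooted tame tree-decomposition displays a set $\Psi\subseteq\Gamma(G)$ if: $\sigma$ restricts to a bijection from the ends in $\Psi$ to the ends of $T$; $\sigma$ restricts to a bijection from the critical vertex sets in $\Psi$ to the infinite-degree nodes of $T$ such that whenever $\sigma(X)=t$ for a critical $X\in\Psi$, then $t$ has a predecessor $s$ with $\alpha(s,t)=(X,\mathcal C)$ for some cofinite $\mathcal C\subseteq\breve{\mathcal C}_X$ and $s'\mapsto\alpha(s',t)$ is a bijection from the neighbours $s'$ of $t$ to the set consisting of $(X,\mathcal C)$ and all $(C,X)$ with $C\in\mathcal C$; and $\sigma$ sends every element of $\Gamma(G)\setminus\Psi$ to a finite-degree node of $T$. -/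

import Mathlib

universe u v

namespace StarComb

/-! ### Rays and ends -/

/-- A ray of `G`: a one-way infinite path, given as its sequence of vertices. -/
structure Ray {V : Type u} (G : SimpleGraph V) where
  vert : ℕ → V
  injective : Function.Injective vert
  adj : ∀ n, G.Adj (vert n) (vert (n + 1))

/-- The ray `R` has a tail in the vertex set `S`. -/
def Ray.TailIn {V : Type u} {G : SimpleGraph V} (R : Ray G) (S : Set V) : Prop :=
  ∃ n, ∀ m, n ≤ m → R.vert m ∈ S

theorem Ray.exists_tailIn {V : Type u} {G : SimpleGraph V} (R : Ray G) (X : Set V)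
    (hX : X.Finite) : ∃ C : G.ComponentCompl X, R.TailIn (C : Set V) := by
  have hfin : (R.vert ⁻¹' X).Finite := hX.preimage R.injective.injOn
  obtain ⟨N, hN⟩ := hfin.bddAbove
  have hout : ∀ m, N + 1 ≤ m → R.vert m ∉ X := fun m hm hmem => by
    have := hN hmem
    omega
  refine ⟨G.componentComplMk (hout (N + 1) le_rfl), N + 1, fun m hm => ?_⟩
  induction m, hm using Nat.le_induction with
  | base => exact ⟨hout _ le_rfl, rfl⟩
  | succ m hm ih =>
    exact SimpleGraph.ComponentCompl.mem_of_adj _ _ ih (hout (m + 1) (by omega)) (R.adj m)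

theorem Ray.TailIn.component_eq {V : Type u} {G : SimpleGraph V} {R : Ray G} {X : Set V}
    {C D : G.ComponentCompl X} (hC : R.TailIn (C : Set V)) (hD : R.TailIn (D : Set V)) :
    C = D := by
  obtain ⟨n, hn⟩ := hC
  obtain ⟨m, hm⟩ := hD
  obtain ⟨_, h₁⟩ := hn (max n m) (le_max_left _ _)
  obtain ⟨_, h₂⟩ := hm (max n m) (le_max_right _ _)
  exact h₁.symm.trans h₂

/-- Two rays are equivalent if for every finite vertex set `X` both have a tail in the same
component of `G - X`. -/
def rayEquiv {V : Type u} (G : SimpleGraph V) : Setoid (Ray G) where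
  r R S := ∀ X : Set V, X.Finite →
    ∃ C : G.ComponentCompl X, R.TailIn (C : Set V) ∧ S.TailIn (C : Set V)
  iseqv :=
    { refl := fun R X hX => (R.exists_tailIn X hX).imp fun _ h => ⟨h, h⟩
      symm := fun h X hX => (h X hX).imp fun _ h => ⟨h.2, h.1⟩
      trans := fun h k X hX => by
        obtain ⟨C, h₁, h₂⟩ := h X hX
        obtain ⟨D, k₁, k₂⟩ := k X hX
        obtain rfl := h₂.component_eq k₁
        exact ⟨C, h₁, k₂⟩ }

/-- The ends of `G`: equivalence classes of rays. -/
def Ends {V : Type u} (G : SimpleGraph V) : Type u := Quotient (rayEquiv G)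

/-- The end of `G` that contains the ray `R`. -/
def Ray.toEnd {V : Type u} {G : SimpleGraph V} (R : Ray G) : Ends G :=
  Quotient.mk (rayEquiv G) R

/-- Every ray in the end `ω` has a tail in `S`. If `S` is a component of `G - X` with `X` finite,
this says that `ω` lives in `S`. -/
def Ends.TailIn {V : Type u} {G : SimpleGraph V} (ω : Ends G) (S : Set V) : Prop :=
  ∀ R : Ray G, R.toEnd = ω → R.TailIn S

/-- The end `ω` lies in the closure of the vertex set `M`: for every finite `X`, the component of
`G - X` in which `ω` lives meets `M`. -/
def Ends.InClosure {V : Type u} {G : SimpleGraph V} (ω : Ends G) (M : Set V) : Prop :=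
  ∀ X : Set V, X.Finite →
    ∃ C : G.ComponentCompl X, ω.TailIn (C : Set V) ∧ ((C : Set V) ∩ M).Nonempty

/-! ### Critical vertex sets and the combinatorial remainder -/

/-- The neighbourhood `N(S)` of a vertex set `S`. -/
def nbhd {V : Type u} (G : SimpleGraph V) (S : Set V) : Set V :=
  {v | v ∉ S ∧ ∃ w ∈ S, G.Adj v w}

/-- The components of `G - X` whose neighbourhood is precisely `Y`. -/
def componentsWithNbhd {V : Type u} (G : SimpleGraph V) (X Y : Set V) :
    Set (G.ComponentCompl X) :=
  {C | nbhd G (C : Set V) = Y}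

/-- The critical vertex sets of `G`: the finite sets `X` such that infinitely many components of
`G - X` have neighbourhood precisely `X`. -/
def Crit {V : Type u} (G : SimpleGraph V) : Type u :=
  {X : Set V // X.Finite ∧ (componentsWithNbhd G X X).Infinite}

/-- The critical vertex set `X` lies in the closure of `M`: infinitely many of the components of
`G - X` with neighbourhood `X` meet `M`. -/
def Crit.InClosure {V : Type u} {G : SimpleGraph V} (X : Crit G) (M : Set V) : Prop :=
  {C ∈ componentsWithNbhd G X.1 X.1 | ((C : Set V) ∩ M).Nonempty}.Infinite

/-- The combinatorial remainder `Γ(G)`: the disjoint union of the ends and the critical vertex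
sets. -/
abbrev Remainder {V : Type u} (G : SimpleGraph V) : Type u := Ends G ⊕ Crit G

/-- `∂_Γ M`: the elements of the combinatorial remainder that lie in the closure of `M`. -/
def boundary {V : Type u} (G : SimpleGraph V) (M : Set V) : Set (Remainder G) :=
  {γ | Sum.elim (fun ω : Ends G => ω.InClosure M) (fun X : Crit G => X.InClosure M) γ}

/-! ### Stars -/

/-- `G` contains a star attached to `U`: a subdivided infinite star (with centre `c`, set of leaves
`L`, and for each leaf `l` the path from `c` to `l`) all whose leaves lie in `U`. -/
def HasStarAttachedTo {V : Type u} (G : SimpleGraph V) (U : Set V) : Prop :=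
  ∃ (c : V) (L : Set V) (P : (l : L) → G.Path c l),
    L.Infinite ∧ L ⊆ U ∧ c ∉ L ∧
    ∀ l l' : L, l ≠ l' →
      ∀ x, x ∈ (P l : G.Walk c l).support → x ∈ (P l' : G.Walk c l').support → x = c

/-! ### Separations -/

/-- The vertex set `V[𝒞]` of a collection of components of `G - X`. -/
def vertsOf {V : Type u} {G : SimpleGraph V} {X : Set V} (𝒞 : Set (G.ComponentCompl X)) : Set V :=
  ⋃ C ∈ 𝒞, (C : Set V)

/-- The oriented separation `(X, 𝒞) = (V ∖ V[𝒞], X ∪ V[𝒞])`. -/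
def sepOf {V : Type u} {G : SimpleGraph V} {X : Set V} (𝒞 : Set (G.ComponentCompl X)) :
    Set V × Set V :=
  ((vertsOf 𝒞)ᶜ, X ∪ vertsOf 𝒞)

/-- The separation `{A, B}` (given with one of its orientations) has finite order and is tame:
it has the form `{X, 𝒞}`, and for no `Y ⊆ X` do both `𝒞` and its complement contain infinitely many
components with neighbourhood precisely `Y`. -/
def IsTame {V : Type u} (G : SimpleGraph V) (p : Set V × Set V) : Prop :=
  (p.1 ∩ p.2).Finite ∧
  ∃ 𝒞 : Set (G.ComponentCompl (p.1 ∩ p.2)), p = sepOf 𝒞 ∧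
    ∀ Y ⊆ p.1 ∩ p.2,
      ¬ ((𝒞 ∩ componentsWithNbhd G (p.1 ∩ p.2) Y).Infinite ∧
        (𝒞ᶜ ∩ componentsWithNbhd G (p.1 ∩ p.2) Y).Infinite)

/-! ### Tree-decompositions -/

/-- A tree-decomposition of `G` with decomposition tree on the set `I` of nodes. -/
structure TreeDecomposition {V : Type u} (G : SimpleGraph V) (I : Type v) where
  tree : SimpleGraph I
  isTree : tree.IsTree
  part : I → Set V
  exists_mem : ∀ x, ∃ t, x ∈ part t
  exists_edge : ∀ x y, G.Adj x y → ∃ t, x ∈ part t ∧ y ∈ part t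
  inter_subset : ∀ (t₁ t₂ t₃ : I) (p : tree.Path t₁ t₃), t₂ ∈ (p : tree.Walk t₁ t₃).support →
    part t₁ ∩ part t₃ ⊆ part t₂

namespace TreeDecomposition

variable {V : Type u} {G : SimpleGraph V} {I : Type v} (D : TreeDecomposition G I)

/-- The adhesion set (separator) at the edge `st` of the decomposition tree. -/
def adhesion (s t : I) : Set V := D.part s ∩ D.part t

/-- The decomposition tree is locally finite. -/
def IsLocallyFinite : Prop := ∀ t, (D.tree.neighborSet t).Finite

/-- All separators are finite. -/
def FiniteSeparators : Prop := ∀ s t, D.tree.Adj s t → (D.adhesion s t).Finite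

/-- Separators at distinct edges of the decomposition tree are disjoint. -/
def DisjointSeparators : Prop :=
  ∀ s t s' t', D.tree.Adj s t → D.tree.Adj s' t' → s(s, t) ≠ s(s', t') →
    Disjoint (D.adhesion s t) (D.adhesion s' t')

/-- All separators induce connected subgraphs of `G`. -/
def ConnectedSeparators : Prop :=
  ∀ s t, D.tree.Adj s t → (G.induce (D.adhesion s t)).Connected

/-- For an edge `st` of the tree `T`, the union of the parts at the nodes in the component of
`T - st` that contains `t`. -/
def side (s t : I) : Set V :=
  ⋃ x ∈ {x | (D.tree.deleteEdges {s(s, t)}).Reachable t x}, D.part x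

/-- The oriented separation `α(s, t)` induced by the oriented edge `(s, t)` of the tree. -/
def sep (s t : I) : Set V × Set V := (D.side t s, D.side s t)

/-- The element `γ` of the combinatorial remainder orients the edge `st` from `s` to `t`, that is,
it orients the separation at `st` towards the side of `t`: an end does so if all its rays have a
tail in that side, and a critical vertex set `X` does so if that side contains `X` and all but
finitely many of the components of `G - X` with neighbourhood `X`. -/
def Orients : Remainder G → I → I → Prop
  | Sum.inl ω, s, t => ω.TailIn (D.side s t)
  | Sum.inr X, s, t =>
      X.1 ⊆ D.side s t ∧ {C ∈ componentsWithNbhd G X.1 X.1 | ¬ (C : Set V) ⊆ D.side s t}.Finite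

/-- `γ` lives at the node `t`: it orients all the edges at `t` towards `t`. -/
def LivesAt (γ : Remainder G) (t : I) : Prop :=
  ∀ s, D.tree.Adj s t → D.Orients γ s t

/-- `γ` corresponds to the end `η` of the tree: it orients all the edges of some ray in `η`
forwards. -/
def CorrespondsTo (γ : Remainder G) (η : Ends D.tree) : Prop :=
  ∃ W : Ray D.tree, W.toEnd = η ∧ ∀ n, D.Orients γ (W.vert n) (W.vert (n + 1))

/-- `γ` corresponds to the given end, or lives at the given node, of the tree. -/
def Sends (γ : Remainder G) : Ends D.tree ⊕ I → Prop
  | Sum.inl η => D.CorrespondsTo γ η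
  | Sum.inr t => D.LivesAt γ t

/-- The tree-decomposition, rooted at `r`, is tame and displays the subset `Ψ` of the combinatorial
remainder of `G`. -/
def Displays (r : I) (Ψ : Set (Remainder G)) : Prop :=
  (∀ s t, D.tree.Adj s t → IsTame G (D.sep s t)) ∧
  ∃ σ : Remainder G → Ends D.tree ⊕ I,
    (∀ γ, D.Sends γ (σ γ)) ∧
    Set.BijOn σ (Ψ ∩ Set.range Sum.inl) (Set.range Sum.inl) ∧
    Set.BijOn σ (Ψ ∩ Set.range Sum.inr) (Sum.inr '' {t | (D.tree.neighborSet t).Infinite}) ∧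
    (∀ X : Crit G, Sum.inr X ∈ Ψ → ∀ t, σ (Sum.inr X) = Sum.inr t →
      ∃ s, D.tree.Adj s t ∧ (∃ p : D.tree.Path r t, s ∈ (p : D.tree.Walk r t).support) ∧
        ∃ 𝒞 ⊆ componentsWithNbhd G X.1 X.1, (componentsWithNbhd G X.1 X.1 \ 𝒞).Finite ∧
          D.sep s t = sepOf 𝒞 ∧
          Set.BijOn (fun s' => D.sep s' t) (D.tree.neighborSet t)
            (insert (sepOf 𝒞) ((fun C => (sepOf {C}).swap) '' 𝒞))) ∧
    (∀ γ ∉ Ψ, ∃ t, (D.tree.neighborSet t).Finite ∧ σ γ = Sum.inr t)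

/-- The tree-decomposition is locally finite, its separators are finite and pairwise disjoint, and
each of its parts contains only finitely many vertices of `U`. -/
structure IsComplementaryToStar (U : Set V) : Prop where
  locallyFinite : D.IsLocallyFinite
  finite_separators : D.FiniteSeparators
  disjoint_separators : D.DisjointSeparators
  finite_inter : ∀ t, (D.part t ∩ U).Finite

end TreeDecomposition

end StarComb

/-!
A star and a tree-decomposition as described cannot coexist (`not_hasStarAttachedTo`): the centre
`c` of a star lies in only finitely many parts, which are surrounded by finitely many finite
separators avoiding `c`; but infinitely many paths of the star, disjoint outside `c`, would have to
leave these parts.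

Conversely, suppose that no star is attached to `U`. A maximal system of `v`–`U` paths that meet
only in `v` is then finite, so `v` can be separated from `U ∖ {v}` by a finite set avoiding `v`.
Hence every finite set `N` can be separated from `U ∖ N` by a finite set disjoint from `N`
(`exists_separating_set`), and deleting a finite set leaves only finitely many components meeting
`U` (`finite_components_meeting`). Iterating this yields a nested system of connected *regions*:
starting from the whole vertex set, choose in each region `D` a finite connected *core* which
separates the neighbourhood of `D` from the vertices of `U` in `D` outside the core, and pass to the
components of `D` minus its core that meet `U` (`exists_regionTree`). The regions form a locally
finite rooted tree by inclusion (`RegionTree`), and each vertex `x` has a region `deepest x` of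
maximal depth containing it. Putting `x` into the part at the parent of `deepest x`, and also into
the part at `deepest x` if `x` lies in its core, gives a tree-decomposition whose separators are
precisely the cores, which are finite, connected and disjoint.

For the display, the separation at the edge above a node `t` has the components that are regions of
children of `t` on one side, so it is tame as these are finitely many. A critical vertex set cannot
be separated by a finite set, so it follows regions downwards until it stops at some `t`, and then
it lives at the parent of `t` (`crit_livesAt`). So does an end, unless it lives in an infinite
descending sequence of regions (`end_dichotomy`). The latter happens precisely for the ends in the
closure of `U`, since regions meet `U` and regions of large depth avoid any given finite set.
For the same reason such an end is determined by its sequence; and every descending sequence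
is followed by an end, by `exists_ray_of_nested`.
-/

namespace StarComb

/-! ### Connected sets and components -/

section Connectivity

variable {V : Type u} {G : SimpleGraph V}

theorem subset_of_connected_of_closed {D S : Set V} (hD : (G.induce D).Preconnected) {v : V}
    (hvD : v ∈ D) (hvS : v ∈ S)
    (hcl : ∀ a ∈ D, a ∈ S → ∀ b ∈ D, G.Adj a b → b ∈ S) : D ⊆ S := by
  intro w hw
  by_contra hwS
  obtain ⟨p⟩ := hD ⟨v, hvD⟩ ⟨w, hw⟩
  obtain ⟨d, -, h₁, h₂⟩ := p.exists_boundary_dart (Subtype.val ⁻¹' S) hvS hwS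
  exact h₂ (hcl _ d.fst.2 h₁ _ d.snd.2 d.adj)

theorem component_subset_of_closed {X S : Set V} (C : G.ComponentCompl X) {v : V}
    (hvC : v ∈ C) (hvS : v ∈ S)
    (hcl : ∀ a ∈ C, a ∈ S → ∀ b ∈ C, G.Adj a b → b ∈ S) : (C : Set V) ⊆ S := by
  intro w hw
  by_contra hwS
  obtain ⟨hv, rfl⟩ := hvC
  obtain ⟨hw', e⟩ := id hw
  obtain ⟨p⟩ := SimpleGraph.ConnectedComponent.exact e.symm
  obtain ⟨d, hd, h₁, h₂⟩ := p.exists_boundary_dart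
    (Subtype.val ⁻¹' (S ∩ (G.componentComplMk hv : Set V))) ⟨hvS, hv, rfl⟩ (fun h => hwS h.1)
  have h₃ := SimpleGraph.ComponentCompl.mem_of_adj _ _ h₁.2 d.snd.2 d.adj
  exact h₂ ⟨hcl _ h₁.2 h₁.1 _ h₃ d.adj, h₃⟩

theorem subset_component {X D : Set V} (hD : (G.induce D).Preconnected) (hX : Disjoint D X)
    (C : G.ComponentCompl X) {v : V} (hvD : v ∈ D) (hvC : v ∈ C) : D ⊆ (C : Set V) :=
  subset_of_connected_of_closed hD hvD hvC fun a _ haC _ hb hab =>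
    SimpleGraph.ComponentCompl.mem_of_adj a _ haC (Set.disjoint_left.1 hX hb) hab

theorem component_connected {X : Set V} (C : G.ComponentCompl X) :
    (G.induce (C : Set V)).Connected := by
  obtain ⟨v, hv⟩ := C.nonempty
  rw [SimpleGraph.connected_iff_exists_forall_reachable]
  refine ⟨⟨v, hv⟩, fun ⟨w, hw⟩ => ?_⟩
  have := component_subset_of_closed (S := {w | ∃ h : w ∈ C,
    (G.induce (C : Set V)).Reachable ⟨v, hv⟩ ⟨w, h⟩}) C hv ⟨hv, .refl _⟩
    (fun a ha ⟨_, h⟩ b hb hab => ⟨hb, h.trans (SimpleGraph.Adj.reachable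
      (show (G.induce (C : Set V)).Adj ⟨a, ha⟩ ⟨b, hb⟩ from hab))⟩)
  exact (this hw).2

theorem component_nbhd_subset {X : Set V} (C : G.ComponentCompl X) : nbhd G (C : Set V) ⊆ X := by
  rintro v ⟨hv, w, hw, hvw⟩
  by_contra hX
  exact hv (SimpleGraph.ComponentCompl.mem_of_adj w v hw hX hvw.symm)

theorem component_eq_of_mem {X : Set V} {C D : G.ComponentCompl X} {v : V} (hC : v ∈ C)
    (hD : v ∈ D) : C = D := by
  obtain ⟨_, h₁⟩ := hC
  obtain ⟨_, h₂⟩ := hD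
  exact h₁.symm.trans h₂

/-- A connected set that avoids `X` and contains a vertex of a set whose neighbourhood lies in `X`
is contained in that set. -/
theorem subset_of_nbhd_subset {X D S : Set V} (hD : (G.induce D).Preconnected)
    (hX : Disjoint D X) (hS : nbhd G S ⊆ X) {v : V} (hvD : v ∈ D) (hvS : v ∈ S) : D ⊆ S := by
  refine subset_of_connected_of_closed hD hvD hvS fun a _ haS b hb hab => ?_
  by_contra hbS
  exact Set.disjoint_left.1 hX hb (hS ⟨hbS, a, haS, hab.symm⟩)

theorem exists_component_eq {X D : Set V} (hD : (G.induce D).Connected) (hX : Disjoint D X)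
    (hN : nbhd G D ⊆ X) : ∃ C : G.ComponentCompl X, (C : Set V) = D := by
  obtain ⟨⟨v, hv⟩⟩ := hD.nonempty
  refine ⟨G.componentComplMk (Set.disjoint_left.1 hX hv), ?_⟩
  have hm := G.componentComplMk_mem (Set.disjoint_left.1 hX hv)
  exact (subset_of_nbhd_subset (component_connected _).preconnected
    (SimpleGraph.ComponentCompl.disjoint_right _).symm hN hm hv).antisymm
    (subset_component hD.preconnected hX _ hv hm)

theorem exists_finite_connected_superset {A D : Set V} (hD : (G.induce D).Connected)
    (hA : A.Finite) (hAD : A ⊆ D) :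
    ∃ Y, A ⊆ Y ∧ Y ⊆ D ∧ Y.Finite ∧ (G.induce Y).Connected := by
  classical
  obtain ⟨v⟩ := hD.nonempty
  have hA' : (Subtype.val ⁻¹' A : Set D).Finite := hA.preimage Subtype.val_injective.injOn
  obtain ⟨T, hT, hconn⟩ := (G.induce D).extend_finset_to_connected hD.preconnected
    (t := insert v hA'.toFinset) (Finset.insert_nonempty _ _)
  refine ⟨Subtype.val '' (T : Set D), fun a ha => ⟨⟨a, hAD ha⟩, hT ?_, rfl⟩, ?_,
    T.finite_toSet.image _, ?_⟩
  · exact Finset.mem_insert_of_mem (hA'.mem_toFinset.2 ha)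
  · rintro _ ⟨x, -, rfl⟩
    exact x.2
  · let f : (G.induce D).induce (T : Set D) →g G.induce (Subtype.val '' (T : Set D)) :=
      ⟨fun x => ⟨x.1.1, x.1, x.2, rfl⟩, fun h => h⟩
    refine hconn.map f ?_
    rintro ⟨_, x, hx, rfl⟩
    exact ⟨⟨x, hx⟩, rfl⟩

theorem exists_path_within {D : Set V} (hD : (G.induce D).Preconnected) {v w : V} (hv : v ∈ D)
    (hw : w ∈ D) : ∃ q : G.Path v w, ∀ x ∈ (q : G.Walk v w).support, x ∈ D := by
  classical
  have key : ∀ a b : D, (G.induce D).Walk a b → ∃ q : G.Walk a b, ∀ x ∈ q.support, x ∈ D := by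
    intro a b p
    induction p with
    | nil => exact ⟨.nil, by simp⟩
    | @cons a b c hab _ ih =>
      obtain ⟨q, hq⟩ := ih
      have hab' : G.Adj (a : V) b := hab
      refine ⟨.cons hab' q, fun x hx => ?_⟩
      rw [SimpleGraph.Walk.support_cons, List.mem_cons] at hx
      rcases hx with rfl | hx
      · exact a.2
      · exact hq x hx
  obtain ⟨p⟩ := hD ⟨v, hv⟩ ⟨w, hw⟩
  obtain ⟨q, hq⟩ := key _ _ p
  exact ⟨q.toPath, fun x hx => hq x (SimpleGraph.Walk.support_toPath_subset_support _ hx)⟩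

theorem nbhd_nonempty (hG : G.Connected) {S : Set V} (hS : S.Nonempty) (hS' : S ≠ Set.univ) :
    (nbhd G S).Nonempty := by
  obtain ⟨v, hv⟩ := hS
  obtain ⟨w, hw⟩ := (Set.ne_univ_iff_exists_notMem _).1 hS'
  obtain ⟨p⟩ := hG.preconnected v w
  obtain ⟨d, -, h₁, h₂⟩ := p.exists_boundary_dart S hv hw
  exact ⟨d.snd, h₂, d.fst, h₁, d.adj.symm⟩

theorem connected_insert {S : Set V} (hS : (G.induce S).Connected) {v : V} (hv : v ∈ nbhd G S) :
    (G.induce (insert v S)).Connected := by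
  obtain ⟨-, w, hw, hvw⟩ := hv
  have := SimpleGraph.induce_union_connected
    (SimpleGraph.induce_pair_connected_of_adj hvw).preconnected hS.preconnected
    ⟨w, by simp, hw⟩
  rwa [show ({v, w} : Set V) ∪ S = insert v S by
    rw [Set.insert_union, Set.singleton_union, Set.insert_eq_of_mem hw]] at this

end Connectivity

/-! ### Separating vertices from `U` in the absence of a star -/

section Star

variable {V : Type u} {G : SimpleGraph V} {U : Set V}

/-- If no star is attached to `U`, then a maximal family of `v`–`U` paths meeting pairwise only in
`v` is finite, so every vertex `v` can be separated from `U ∖ {v}` by a finite set avoiding `v`. -/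
theorem exists_separating_vertex (h : ¬ HasStarAttachedTo G U) (v : V) :
    ∃ S : Set V, S.Finite ∧ v ∉ S ∧ ∀ C : G.ComponentCompl S, v ∈ C → ∀ w ∈ C, w ∈ U → w = v := by
  classical
  by_contra! hS
  refine h ?_
  have : Std.Symm fun p q : Σ w : V, G.Path v w =>
      ∀ x, x ∈ (p.2 : G.Walk v p.1).support → x ∈ (q.2 : G.Walk v q.1).support → x = v :=
    ⟨fun p q h x hx hx' => h x hx' hx⟩
  obtain ⟨f, hf, hr⟩ := exists_seq_of_forall_finset_exists'
    (α := Σ w : V, G.Path v w) (fun p => p.1 ∈ U ∧ p.1 ≠ v)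
    (fun p q => ∀ x, x ∈ (p.2 : G.Walk v p.1).support → x ∈ (q.2 : G.Walk v q.1).support → x = v)
    (fun F _ => by
      obtain ⟨C, hvC, w, hw, hwU, hwv⟩ := hS
        (⋃ p ∈ F, {x | x ∈ (p.2 : G.Walk v p.1).support ∧ x ≠ v})
        (F.finite_toSet.biUnion fun p _ =>
          (List.finite_toSet (p.2 : G.Walk v p.1).support).subset fun x hx => hx.1) (by simp)
      obtain ⟨q, hq⟩ := exists_path_within (component_connected C).preconnected hvC hw
      refine ⟨⟨w, q⟩, ⟨hwU, hwv⟩, fun p hp x hx hx' => ?_⟩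
      by_contra hxv
      refine SimpleGraph.ComponentCompl.notMem_of_mem
        (hq x hx') ?_
      simp only [Set.mem_iUnion]
      exact ⟨p, hp, hx, hxv⟩)
  have hinj : Function.Injective fun n => (f n).1 := by
    intro m n hmn
    by_contra hne
    refine (hf n).2 (hr hne _ ?_ (SimpleGraph.Walk.end_mem_support _))
    exact Eq.mp (congrArg (fun z => z ∈ ((f m).2 : G.Walk v (f m).1).support) hmn)
      (SimpleGraph.Walk.end_mem_support _)
  have key : ∀ l : Set.range fun n => (f n).1, ∃ n, ∃ P : G.Path v l,
      (f n) = ⟨l, P⟩ := by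
    rintro ⟨_, n, rfl⟩
    exact ⟨n, (f n).2, rfl⟩
  choose n P hP using key
  refine ⟨v, Set.range fun n => (f n).1, P, Set.infinite_range_of_injective hinj, ?_, ?_, ?_⟩
  · rintro _ ⟨n, rfl⟩
    exact (hf n).1
  · rintro ⟨n, hn⟩
    exact (hf n).2 hn
  · intro l l' hll x hx hx'
    have hne : n l ≠ n l' := fun e => hll (Subtype.ext (by
      have h₁ := congrArg Sigma.fst (hP l)
      have h₂ := congrArg Sigma.fst (hP l')
      rw [e] at h₁
      exact h₁.symm.trans h₂))
    refine hr hne x ?_ ?_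
    · rw [hP l]
      exact hx
    · rw [hP l']
      exact hx'

/-- The version of `exists_separating_vertex` for finite vertex sets: since the last vertex in `N`
of a path from `N` to `U ∖ N` is separated from `U`, the union of the separators of the single
vertices, with `N` removed, separates `N` from `U ∖ N`. -/
theorem exists_separating_set (h : ¬ HasStarAttachedTo G U) {N : Set V} (hN : N.Finite) :
    ∃ S : Set V, S.Finite ∧ Disjoint S N ∧
      ∀ C : G.ComponentCompl S, ((C : Set V) ∩ N).Nonempty → ∀ w ∈ C, w ∈ U → w ∈ N := by
  choose S hS hvS hC using exists_separating_vertex h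
  refine ⟨(⋃ v ∈ N, S v) \ N, (hN.biUnion fun v _ => hS v).subset Set.sdiff_subset,
    Set.disjoint_sdiff_left, ?_⟩
  rintro C ⟨n, hnC, hnN⟩ u huC huU
  by_contra huN
  have hu : u ∉ (⋃ v ∈ N, S v) ∪ N := by
    rintro (hu | hu)
    · exact SimpleGraph.ComponentCompl.notMem_of_mem huC ⟨hu, huN⟩
    · exact huN hu
  let K := G.componentComplMk hu
  have hKN : Disjoint (K : Set V) N :=
    K.disjoint_right.symm.mono_right Set.subset_union_right
  have huK : u ∈ K := G.componentComplMk_mem hu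
  -- the component `K` of `u` in `G - N` attaches to some vertex of `N`
  obtain ⟨m, hmN, hm⟩ : ∃ m ∈ N, m ∈ nbhd G (K : Set V) := by
    by_contra! hno
    refine Set.disjoint_left.1 hKN (component_subset_of_closed C huC huK ?_ hnC) hnN
    intro a haC haK b hbC hab
    by_contra hbK
    have hb : b ∈ nbhd G (K : Set V) := ⟨hbK, a, haK, hab.symm⟩
    rcases component_nbhd_subset K hb with hb' | hb'
    · by_cases hbN : b ∈ N
      · exact hno b hbN hb
      · exact SimpleGraph.ComponentCompl.notMem_of_mem hbC ⟨hb', hbN⟩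
    · exact hno b hb' hb
  have hdis : Disjoint (insert m (K : Set V)) (S m) := by
    rw [Set.disjoint_insert_left]
    exact ⟨hvS m, K.disjoint_right.symm.mono_right
      ((Set.subset_biUnion_of_mem hmN).trans Set.subset_union_left)⟩
  have hsub := subset_component (connected_insert (component_connected K) hm).preconnected hdis
    (G.componentComplMk (hvS m)) (Set.mem_insert m _) (G.componentComplMk_mem _)
  have := hC m _ (G.componentComplMk_mem (hvS m)) u (hsub (Set.mem_insert_of_mem _ huK)) huU
  exact huN (this ▸ hmN)

theorem finite_components_meeting (hG : G.Connected) (h : ¬ HasStarAttachedTo G U) {X : Set V}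
    (hX : X.Finite) : {C : G.ComponentCompl X | ((C : Set V) ∩ U).Nonempty}.Finite := by
  obtain ⟨S, hS, hSX, hsep⟩ := exists_separating_set h hX
  -- every component other than `G` itself that meets `U` contains a vertex of `S`
  have hsub : {C : G.ComponentCompl X | ((C : Set V) ∩ U).Nonempty} ⊆
      (⋃ s ∈ S, {C | s ∈ C}) ∪ {C | (C : Set V) = Set.univ} := by
    rintro C ⟨u, huC, huU⟩
    by_contra hC
    simp only [Set.mem_union, Set.mem_iUnion, Set.mem_ofPred_eq, not_or, not_exists] at hC
    obtain ⟨m, hm⟩ := nbhd_nonempty hG C.nonempty hC.2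
    have hmX := component_nbhd_subset C hm
    have hmS : m ∉ S := fun hms => Set.disjoint_left.1 hSX hms hmX
    have hdis : Disjoint (insert m (C : Set V)) S := by
      rw [Set.disjoint_insert_left]
      exact ⟨hmS, Set.disjoint_left.2 fun x hxC hxS => hC.1 x hxS hxC⟩
    have hsub := subset_component (connected_insert (component_connected C) hm).preconnected hdis
      (G.componentComplMk hmS) (Set.mem_insert m _) (G.componentComplMk_mem _)
    exact SimpleGraph.ComponentCompl.notMem_of_mem huC
      (hsep _ ⟨m, G.componentComplMk_mem hmS, hmX⟩ u (hsub (Set.mem_insert_of_mem _ huC)) huU)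
  refine Set.Finite.subset ((hS.biUnion fun s _ => ?_).union ?_) hsub
  · exact Set.Subsingleton.finite fun C hC D hD => component_eq_of_mem hC hD
  · exact Set.Subsingleton.finite fun C hC D hD =>
      SimpleGraph.ComponentCompl.coe_inj.1 (Eq.trans hC (Eq.symm hD))

theorem boundary_subset_ends (hG : G.Connected) (h : ¬ HasStarAttachedTo G U) :
    boundary G U ⊆ Set.range Sum.inl := by
  rintro (ω | X) hγ
  · exact ⟨ω, rfl⟩
  · exact absurd ((finite_components_meeting hG h X.2.1).subset fun C hC => hC.2) hγ

end Star

/-! ### Rooted trees given by a parent function -/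

/-- A rooted tree on the node set `I`, given by the map sending each node to its parent; the root
is its own parent. The depth function makes the parent map well-founded. -/
structure ParentTree (I : Type v) where
  root : I
  parent : I → I
  depth : I → ℕ
  parent_root : parent root = root
  depth_root : depth root = 0
  depth_parent : ∀ t, t ≠ root → depth (parent t) + 1 = depth t

namespace ParentTree

variable {I : Type v} (T : ParentTree I)

/-- `t` is a child of `s`. -/
def IsChild (s t : I) : Prop := t ≠ T.root ∧ T.parent t = s

/-- `s` is an ancestor of `t`; every node counts as an ancestor of itself. -/
def Anc (s t : I) : Prop := ∃ n, T.parent^[n] t = s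

/-- The underlying graph of a rooted tree. -/
def graph : SimpleGraph I where
  Adj s t := T.IsChild s t ∨ T.IsChild t s
  symm := ⟨fun _ _ h => h.symm⟩
  loopless := ⟨fun t h => by
    have h' : T.IsChild t t := h.elim id id
    have := T.depth_parent t h'.1
    rw [h'.2] at this
    omega⟩

variable {T}

theorem IsChild.depth_eq {s t : I} (h : T.IsChild s t) : T.depth t = T.depth s + 1 := by
  rw [← T.depth_parent t h.1, h.2]

theorem IsChild.ne {s t : I} (h : T.IsChild s t) : t ≠ s := by
  rintro rfl
  have := h.depth_eq
  omega

theorem anc_refl (t : I) : T.Anc t t := ⟨0, rfl⟩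

theorem anc_iff {s t : I} : T.Anc s t ↔ t = s ∨ (t ≠ T.root ∧ T.Anc s (T.parent t)) := by
  constructor
  · rintro ⟨n, hn⟩
    by_cases ht : t = T.root
    · subst ht
      rw [Function.iterate_fixed T.parent_root] at hn
      exact .inl hn
    · cases n with
      | zero => exact .inl hn
      | succ n => exact .inr ⟨ht, n, hn⟩
  · rintro (rfl | ⟨-, n, hn⟩)
    · exact anc_refl t
    · exact ⟨n + 1, hn⟩

theorem Anc.trans {a b c : I} (h₁ : T.Anc a b) (h₂ : T.Anc b c) : T.Anc a c := by
  obtain ⟨n, rfl⟩ := h₁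
  obtain ⟨m, rfl⟩ := h₂
  exact ⟨n + m, Function.iterate_add_apply _ _ _ _⟩

theorem IsChild.anc {s t : I} (h : T.IsChild s t) : T.Anc s t := ⟨1, h.2⟩

theorem IsChild.anc_parent {s t x : I} (h : T.IsChild s t) (hx : T.Anc t x) :
    x ≠ T.root ∧ T.Anc s (T.parent x) := by
  rcases anc_iff.1 hx with rfl | ⟨h₁, h₂⟩
  · exact ⟨h.1, h.2 ▸ anc_refl _⟩
  · exact ⟨h₁, h.anc.trans h₂⟩

theorem Anc.depth_le {s t : I} (h : T.Anc s t) : T.depth s ≤ T.depth t := by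
  obtain ⟨n, rfl⟩ := h
  induction n with
  | zero => exact le_rfl
  | succ n ih =>
    refine le_trans ?_ ih
    rw [Function.iterate_succ_apply']
    by_cases h : T.parent^[n] t = T.root
    · rw [h, T.parent_root]
    · have := T.depth_parent _ h
      omega

theorem Anc.eq_of_depth {s t : I} (h : T.Anc s t) (hd : T.depth s = T.depth t) : s = t := by
  rcases anc_iff.1 h with rfl | ⟨h₁, h₂⟩
  · rfl
  · have := T.depth_parent t h₁
    have := h₂.depth_le
    omega

theorem anc_total {a b x : I} (ha : T.Anc a x) (hb : T.Anc b x) : T.Anc a b ∨ T.Anc b a := by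
  obtain ⟨n, rfl⟩ := ha
  obtain ⟨m, rfl⟩ := hb
  rcases le_total n m with h | h
  · refine .inr ⟨m - n, ?_⟩
    rw [← Function.iterate_add_apply, Nat.sub_add_cancel h]
  · refine .inl ⟨n - m, ?_⟩
    rw [← Function.iterate_add_apply, Nat.sub_add_cancel h]

theorem Anc.eq_of_anc {a b x : I} (ha : T.Anc a x) (hb : T.Anc b x)
    (hd : T.depth a = T.depth b) : a = b := by
  rcases anc_total ha hb with h | h
  · exact h.eq_of_depth hd
  · exact (h.eq_of_depth hd.symm).symm

theorem depth_induction {P : I → Prop} (h₀ : P T.root)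
    (h : ∀ t, t ≠ T.root → P (T.parent t) → P t) (t : I) : P t := by
  obtain ⟨n, hn⟩ : ∃ n, T.depth t = n := ⟨_, rfl⟩
  induction n generalizing t with
  | zero =>
    by_cases ht : t = T.root
    · exact ht ▸ h₀
    · have := T.depth_parent t ht
      omega
  | succ n ih =>
    by_cases ht : t = T.root
    · exact ht ▸ h₀
    · have := T.depth_parent t ht
      exact h t ht (ih _ (by omega))

theorem anc_root (t : I) : T.Anc T.root t :=
  depth_induction (anc_refl _) (fun _ ht h => anc_iff.2 (.inr ⟨ht, h⟩)) t

theorem Anc.exists_child {s t : I} (h : T.Anc s t) (hne : t ≠ s) :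
    ∃ u, T.IsChild s u ∧ T.Anc u t := by
  induction t using depth_induction (T := T) with
  | h₀ => exact absurd ((anc_iff.1 h).resolve_right fun h => h.1 rfl) hne
  | h t ht ih =>
    have h' := ((anc_iff.1 h).resolve_left hne).2
    by_cases hp : T.parent t = s
    · exact ⟨t, ⟨ht, hp⟩, anc_refl t⟩
    · obtain ⟨u, hu, hut⟩ := ih h' hp
      exact ⟨u, hu, anc_iff.2 (.inr ⟨ht, hut⟩)⟩

/-- Deleting the edge between `t` and its parent leaves exactly the descendants of `t` in the
component of `t`. -/
theorem reachable_child_iff {s t : I} (h : T.IsChild s t) (x : I) :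
    (T.graph.deleteEdges {s(s, t)}).Reachable t x ↔ T.Anc t x := by
  constructor
  · rintro ⟨p⟩
    by_contra hx
    obtain ⟨⟨⟨a, b⟩, hab⟩, -, h₁, h₂⟩ := p.exists_boundary_dart {x | T.Anc t x} (anc_refl t) hx
    rw [SimpleGraph.deleteEdges_adj] at hab
    change T.Anc t a at h₁
    change ¬ T.Anc t b at h₂
    obtain ⟨hab, he⟩ := hab
    change s(a, b) ∉ _ at he
    change T.IsChild a b ∨ T.IsChild b a at hab
    rcases hab with hc | hc
    · exact h₂ (Anc.trans h₁ hc.anc)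
    · rcases anc_iff.1 h₁ with rfl | ⟨-, h₃⟩
      · exact he (by
          rw [Set.mem_singleton_iff, Sym2.eq_swap, ← h.2, ← hc.2])
      · exact h₂ (hc.2 ▸ h₃)
  · intro hx
    induction x using depth_induction (T := T) with
    | h₀ => exact absurd ((anc_iff.1 hx).resolve_right fun h => h.1 rfl) h.1.symm
    | h x hxr ih =>
      rcases anc_iff.1 hx with rfl | ⟨-, h₃⟩
      · exact .refl _
      · refine (ih h₃).trans (SimpleGraph.Adj.reachable ?_)
        rw [SimpleGraph.deleteEdges_adj]
        refine ⟨.inl ⟨hxr, rfl⟩, fun he => ?_⟩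
        rw [Set.mem_singleton_iff, Sym2.eq_iff] at he
        rcases he with ⟨h₄, rfl⟩ | ⟨-, rfl⟩
        · exact absurd h₃.depth_le (by have := T.depth_parent x hxr; omega)
        · exact absurd (h.anc.trans h₃).depth_le (by have := T.depth_parent x hxr; omega)

theorem reachable_parent_iff {s t : I} (h : T.IsChild s t) (x : I) :
    (T.graph.deleteEdges {s(s, t)}).Reachable s x ↔ ¬ T.Anc t x := by
  have key : ∀ x, ¬ T.Anc t x → (T.graph.deleteEdges {s(s, t)}).Reachable T.root x := by
    intro x hx
    induction x using depth_induction (T := T) with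
    | h₀ => exact .refl _
    | h x hxr ih =>
      refine (ih fun h' => hx (anc_iff.2 (.inr ⟨hxr, h'⟩))).trans (SimpleGraph.Adj.reachable ?_)
      rw [SimpleGraph.deleteEdges_adj]
      refine ⟨.inl ⟨hxr, rfl⟩, fun he => ?_⟩
      rw [Set.mem_singleton_iff, Sym2.eq_iff] at he
      rcases he with ⟨-, rfl⟩ | ⟨h₄, rfl⟩
      · exact hx (anc_refl _)
      · exact hx (anc_iff.2 (.inr ⟨hxr, h₄ ▸ anc_refl _⟩))
  have hs : ¬ T.Anc t s := fun h' => by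
    have := h'.depth_le
    have := h.depth_eq
    omega
  refine ⟨fun h₁ h₂ => hs ?_, fun hx => (key s hs).symm.trans (key x hx)⟩
  exact (reachable_child_iff h s).1 (((reachable_child_iff h x).2 h₂).trans h₁.symm)

theorem isTree (T : ParentTree I) : T.graph.IsTree := by
  refine ⟨?_, ?_⟩
  · rw [SimpleGraph.connected_iff_exists_forall_reachable]
    refine ⟨T.root, fun t => ?_⟩
    induction t using depth_induction (T := T) with
    | h₀ => exact .refl _
    | h t ht ih => exact ih.trans (SimpleGraph.Adj.reachable (.inl ⟨ht, rfl⟩))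
  · rw [SimpleGraph.isAcyclic_iff_forall_adj_isBridge]
    have key : ∀ s t, T.IsChild s t → T.graph.IsBridge s(s, t) := by
      intro s t h
      rw [SimpleGraph.isBridge_iff]
      exact fun hr => (reachable_parent_iff h t).1 hr (anc_refl t)
    rintro s t (h | h)
    · exact key s t h
    · rw [Sym2.eq_swap]
      exact key t s h

theorem eq_or_eq_of_mem_path_of_isChild {s t q : I} (h : T.IsChild s t) (p : T.graph.Path s t)
    (hq : q ∈ (p : T.graph.Walk s t).support) : q = s ∨ q = t := by
  have hadj : T.graph.Adj s t := .inl h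
  rw [(T.isTree.isAcyclic.subsingleton_path s t).elim p (SimpleGraph.Path.singleton hadj)] at hq
  simpa [SimpleGraph.Path.singleton] using hq

theorem finite_neighborSet {t : I} (h : {s | T.IsChild t s}.Finite) :
    (T.graph.neighborSet t).Finite := by
  refine (h.union (Set.finite_singleton (T.parent t))).subset ?_
  rintro s (hs | hs)
  · exact .inl hs
  · exact .inr hs.2.symm

/-! ### Rays and ends of rooted trees -/

/-- Every ray of a rooted tree eventually moves away from the root. -/
theorem exists_descending_tail (W : Ray T.graph) :
    ∃ N, ∀ n, N ≤ n → T.IsChild (W.vert n) (W.vert (n + 1)) := by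
  obtain ⟨N, hN⟩ : ∃ N, T.IsChild (W.vert N) (W.vert (N + 1)) := by
    by_contra! hno
    have hd : ∀ n, T.depth (W.vert n) + n = T.depth (W.vert 0) := by
      intro n
      induction n with
      | zero => rfl
      | succ n ih =>
        have := ((W.adj n).resolve_left (hno n)).depth_eq
        omega
    have := hd (T.depth (W.vert 0) + 1)
    omega
  refine ⟨N, fun n hn => ?_⟩
  induction n, hn using Nat.le_induction with
  | base => exact hN
  | succ n hn ih =>
    refine (W.adj (n + 1)).resolve_right fun h => ?_
    have := W.injective (ih.2.symm.trans h.2)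
    omega

/-- The ray of a rooted tree that follows a sequence of successive children. -/
def rayOfChain (c : ℕ → I) (hc : ∀ n, T.IsChild (c n) (c (n + 1))) : Ray T.graph where
  vert := c
  injective := by
    refine (strictMono_nat_of_lt_succ (f := fun n => T.depth (c n)) fun n => ?_).injective.of_comp
    have := (hc n).depth_eq
    omega
  adj n := .inl (hc n)

theorem anc_of_chain {c : ℕ → I} (hc : ∀ n, T.IsChild (c n) (c (n + 1))) {m n : ℕ} (h : m ≤ n) :
    T.Anc (c m) (c n) := by
  induction n, h using Nat.le_induction with
  | base => exact anc_refl _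
  | succ n hn ih => exact ih.trans (hc n).anc

theorem depth_of_chain {c : ℕ → I} (hc : ∀ n, T.IsChild (c n) (c (n + 1))) (n : ℕ) :
    T.depth (c n) = T.depth (c 0) + n := by
  induction n with
  | zero => rfl
  | succ n ih =>
    have := (hc n).depth_eq
    omega

theorem chain_eq_of_toEnd_eq {c c' : ℕ → I} (hc : ∀ n, T.IsChild (c n) (c (n + 1)))
    (hc' : ∀ n, T.IsChild (c' n) (c' (n + 1))) (h₀ : c 0 = c' 0)
    (h : (rayOfChain c hc).toEnd = (rayOfChain c' hc').toEnd) (n : ℕ) : c n = c' n := by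
  obtain ⟨K, ⟨a, ha⟩, ⟨b, hb⟩⟩ := Quotient.exact h {c n} (Set.finite_singleton _)
  -- the descendants of `c n` other than `c n` form a union of components of the tree without `c n`
  have hsub : (K : Set I) ⊆ {q | T.Anc (c n) q} := by
    refine component_subset_of_closed K (ha (max a n) (le_max_left _ _))
      (anc_of_chain hc (le_max_right _ _)) ?_
    rintro x hxK hx y - (hxy | hxy)
    · exact Anc.trans hx hxy.anc
    · rcases anc_iff.1 hx with rfl | ⟨-, h₃⟩
      · exact absurd (Set.mem_singleton _) (SimpleGraph.ComponentCompl.notMem_of_mem hxK)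
      · exact hxy.2 ▸ h₃
  have h₁ : T.Anc (c n) (c' (max b n)) := hsub (hb (max b n) (le_max_left _ _))
  refine h₁.eq_of_anc (anc_of_chain hc' (le_max_right b n)) ?_
  rw [depth_of_chain hc, depth_of_chain hc', h₀]

end ParentTree

theorem Ray.toEnd_eq_of_tail_eq {V : Type u} {G : SimpleGraph V} {R S : Ray G} (a b : ℕ)
    (h : ∀ n, R.vert (a + n) = S.vert (b + n)) : R.toEnd = S.toEnd := by
  refine Quotient.sound fun X hX => ?_
  obtain ⟨C, hC⟩ := R.exists_tailIn X hX
  refine ⟨C, hC, ?_⟩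
  obtain ⟨n, hn⟩ := hC
  refine ⟨b + n, fun m hm => ?_⟩
  have := hn (a + (m - b)) (by omega)
  rw [h] at this
  rwa [show b + (m - b) = m by omega] at this

/-! ### Nested systems of connected regions and their tree-decompositions -/

/-- A rooted tree of connected vertex sets (regions) of `G` that guides a tree-decomposition
adapted to `U`. Each region `region t` contains a finite connected set `core t`; the regions of the
children of `t` are finitely many components of `G - core t` inside `region t`, each meeting `U`,
and together they contain all vertices of `U` in `region t` outside `core t`. -/
structure RegionTree {V : Type u} (G : SimpleGraph V) (U : Set V) (I : Type v) extends
    ParentTree I where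
  region : I → Set V
  core : I → Set V
  region_root : region root = Set.univ
  region_connected : ∀ t, (G.induce (region t)).Connected
  core_subset : ∀ t, core t ⊆ region t
  core_finite : ∀ t, (core t).Finite
  core_connected : ∀ t, (G.induce (core t)).Connected
  region_subset : ∀ s t, toParentTree.IsChild s t → region t ⊆ region s
  nbhd_subset : ∀ s t, toParentTree.IsChild s t → nbhd G (region t) ⊆ core s
  disjoint_core : ∀ s t, toParentTree.IsChild s t → Disjoint (region t) (core s)
  disjoint_siblings : ∀ s t t', toParentTree.IsChild s t → toParentTree.IsChild s t' → t ≠ t' →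
    Disjoint (region t) (region t')
  finite_children : ∀ s, {t | toParentTree.IsChild s t}.Finite
  region_meets : ∀ s t, toParentTree.IsChild s t → (region t ∩ U).Nonempty
  cover : ∀ s, ∀ u ∈ region s, u ∈ U → u ∉ core s → ∃ t, toParentTree.IsChild s t ∧ u ∈ region t

namespace RegionTree

variable {V : Type u} {G : SimpleGraph V} {U : Set V} {I : Type v} (S : RegionTree G U I)

/-- The union of the regions of the children of `t`. -/
def below (t : I) : Set V := {x | ∃ s, S.IsChild t s ∧ x ∈ S.region s}

theorem graph_connected (S : RegionTree G U I) : G.Connected := by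
  have h := S.region_connected S.root
  rw [S.region_root] at h
  exact (SimpleGraph.induceUnivIso G).connected_iff.1 h

theorem mem_root (x : V) : x ∈ S.region S.root := S.region_root ▸ Set.mem_univ x

theorem below_subset (t : I) : S.below t ⊆ S.region t := by
  rintro x ⟨s, hs, hx⟩
  exact S.region_subset _ _ hs hx

theorem disjoint_core_below (t : I) : Disjoint (S.core t) (S.below t) := by
  rw [Set.disjoint_right]
  rintro x ⟨s, hs, hx⟩
  exact Set.disjoint_left.1 (S.disjoint_core _ _ hs) hx

theorem region_mono {s t : I} (h : S.Anc s t) : S.region t ⊆ S.region s := by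
  induction t using ParentTree.depth_induction (T := S.toParentTree) with
  | h₀ =>
    rcases ParentTree.anc_iff.1 h with rfl | h
    · exact subset_rfl
    · exact absurd rfl h.1
  | h t ht ih =>
    rcases ParentTree.anc_iff.1 h with rfl | ⟨-, h⟩
    · exact subset_rfl
    · exact (S.region_subset _ t ⟨ht, rfl⟩).trans (ih h)

theorem mem_parent_of_adj {s t : I} (hst : S.IsChild s t) {x y : V} (hx : x ∈ S.region t)
    (hxy : G.Adj x y) : y ∈ S.region s := by
  by_cases hy : y ∈ S.region t
  · exact S.region_subset _ _ hst hy
  · exact S.core_subset _ (S.nbhd_subset _ _ hst ⟨hy, x, hx, hxy.symm⟩)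

theorem depth_le_of_walk {x y : V} (p : G.Walk x y) (t : I) (hx : x ∈ S.region t) :
    ∃ s, y ∈ S.region s ∧ S.depth t ≤ S.depth s + p.length := by
  induction p generalizing t with
  | nil => exact ⟨t, hx, le_rfl⟩
  | cons h p ih =>
    by_cases ht : t = S.root
    · exact ⟨S.root, S.mem_root _, by rw [ht, S.depth_root]; omega⟩
    · obtain ⟨s, hs, hd⟩ := ih (S.parent t) (S.mem_parent_of_adj ⟨ht, rfl⟩ hx h)
      have := S.depth_parent t ht
      exact ⟨s, hs, by rw [SimpleGraph.Walk.length_cons]; omega⟩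

/-- The depth of the regions containing a given vertex is bounded: it is at most the distance of
that vertex to the core of the root. -/
theorem exists_depth_bound (x : V) : ∃ n, ∀ t, x ∈ S.region t → S.depth t ≤ n := by
  obtain ⟨⟨v, hv⟩⟩ := (S.core_connected S.root).nonempty
  obtain ⟨p⟩ := S.graph_connected.preconnected x v
  refine ⟨p.length, fun t hx => ?_⟩
  obtain ⟨s, hs, hd⟩ := S.depth_le_of_walk p t hx
  by_cases h : s = S.root
  · rw [h, S.depth_root] at hd
    omega
  · obtain ⟨u, hu, hus⟩ := (ParentTree.anc_root (T := S.toParentTree) s).exists_child h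
    exact absurd ⟨u, hu, S.region_mono hus hs⟩
      (Set.disjoint_left.1 (S.disjoint_core_below S.root) hv)

theorem exists_deepest (x : V) : ∃ t, x ∈ S.region t ∧ x ∉ S.below t := by
  by_contra! h
  obtain ⟨n, hn⟩ := S.exists_depth_bound x
  have key : ∀ k, ∃ t, x ∈ S.region t ∧ S.depth t = k := by
    intro k
    induction k with
    | zero => exact ⟨S.root, S.mem_root x, S.depth_root⟩
    | succ k ih =>
      obtain ⟨t, ht, hk⟩ := ih
      obtain ⟨s, hs, hx⟩ := h t ht
      exact ⟨s, hx, by rw [hs.depth_eq, hk]⟩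
  obtain ⟨t, ht, hk⟩ := key (n + 1)
  have := hn t ht
  omega

/-- The node of maximal depth whose region contains `x`. -/
noncomputable def deepest (x : V) : I := (S.exists_deepest x).choose

theorem mem_region_iff {x : V} {t : I} : x ∈ S.region t ↔ S.Anc t (S.deepest x) := by
  obtain ⟨h₁, h₂⟩ := (S.exists_deepest x).choose_spec
  refine ⟨fun hx => ?_, fun h => S.region_mono h h₁⟩
  change x ∉ S.below (S.deepest x) at h₂
  induction t using ParentTree.depth_induction (T := S.toParentTree) with
  | h₀ => exact ParentTree.anc_root _
  | h t ht ih =>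
    have hc : S.IsChild (S.parent t) t := ⟨ht, rfl⟩
    have ha := ih (S.region_subset _ t hc hx)
    by_cases he : S.deepest x = S.parent t
    · exact absurd ⟨t, he ▸ hc, hx⟩ h₂
    · obtain ⟨u, hu, hux⟩ := ha.exists_child he
      by_cases hut : u = t
      · exact hut ▸ hux
      · exact absurd hx
          (Set.disjoint_left.1 (S.disjoint_siblings _ _ _ hu hc hut) (S.region_mono hux h₁))

theorem deepest_eq {x : V} {t : I} (h₁ : x ∈ S.region t) (h₂ : x ∉ S.below t) :
    S.deepest x = t := by
  by_contra he
  obtain ⟨u, hu, hux⟩ := (S.mem_region_iff.1 h₁).exists_child he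
  exact h₂ ⟨u, hu, S.mem_region_iff.2 hux⟩

theorem deepest_of_mem_core {x : V} {t : I} (h : x ∈ S.core t) : S.deepest x = t :=
  S.deepest_eq (S.core_subset t h) (Set.disjoint_left.1 (S.disjoint_core_below t) h)

theorem eq_of_mem_of_depth {x : V} {s t : I} (hs : x ∈ S.region s) (ht : x ∈ S.region t)
    (hd : S.depth s = S.depth t) : s = t :=
  (S.mem_region_iff.1 hs).eq_of_anc (S.mem_region_iff.1 ht) hd

/-- The part at `t`: it consists of the core of `t` and all the vertices whose deepest region is
that of a child of `t`. At the root, which is its own parent, it also contains all the vertices in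
no other region. -/
def bag (t : I) : Set V := {x | S.parent (S.deepest x) = t ∨ S.deepest x = t ∧ x ∈ S.core t}

theorem mem_bag_parent (x : V) : x ∈ S.bag (S.parent (S.deepest x)) := .inl rfl

theorem exists_bag_of_adj {x y : V} (h : G.Adj x y) : ∃ t, x ∈ S.bag t ∧ y ∈ S.bag t := by
  -- if `y` lies in a child `t` of `deepest x`, then `x` lies in the core of `deepest x`, which
  -- contains the neighbourhood of `t`, and `y` cannot lie any deeper
  have key : ∀ x y, G.Adj x y → y ∈ S.region (S.deepest x) → ∃ t, x ∈ S.bag t ∧ y ∈ S.bag t := by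
    intro x y h hy
    by_cases he : S.deepest y = S.deepest x
    · exact ⟨_, S.mem_bag_parent x, he ▸ S.mem_bag_parent y⟩
    obtain ⟨t, ht, hty⟩ := (S.mem_region_iff.1 hy).exists_child he
    have hx : x ∉ S.region t := fun hx => by
      have := (S.mem_region_iff.1 hx).depth_le
      have := ht.depth_eq
      omega
    have hyt : S.deepest y = t := by
      by_contra hyt
      obtain ⟨s, hs, hsy⟩ := hty.exists_child hyt
      exact hx (S.mem_parent_of_adj hs (S.mem_region_iff.2 hsy) h.symm)
    refine ⟨S.deepest x, .inr ⟨rfl, ?_⟩, .inl ?_⟩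
    · exact S.nbhd_subset _ _ ht ⟨hx, y, S.mem_region_iff.2 hty, h⟩
    · rw [hyt, ht.2]
  by_cases hy : y ∈ S.region (S.deepest x)
  · exact key x y h hy
  · have hr : S.deepest x ≠ S.root := fun hr => hy (hr ▸ S.mem_root y)
    have hx : x ∈ S.region (S.deepest x) := S.mem_region_iff.2 (ParentTree.anc_refl _)
    have hc : S.IsChild (S.parent (S.deepest x)) (S.deepest x) := ⟨hr, rfl⟩
    have hyc := S.nbhd_subset _ _ hc ⟨hy, x, hx, h.symm⟩
    have hxy : x ∈ S.region (S.deepest y) := by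
      rw [S.deepest_of_mem_core hyc]
      exact S.region_subset _ _ hc hx
    obtain ⟨t, h₁, h₂⟩ := key y x h.symm hxy
    exact ⟨t, h₂, h₁⟩

/-- The tree-decomposition guided by a region tree. Each vertex `x` lies only in the part at the
parent of `deepest x` and possibly in the part at `deepest x`. -/
def decomposition : TreeDecomposition G I where
  tree := S.graph
  isTree := S.isTree
  part := S.bag
  exists_mem x := ⟨_, S.mem_bag_parent x⟩
  exists_edge _ _ h := S.exists_bag_of_adj h
  inter_subset := by
    rintro t₁ t₂ t₃ p hp x ⟨h₁, h₃⟩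
    have hbag : ∀ t, x ∈ S.bag t → t = S.parent (S.deepest x) ∨ t = S.deepest x := by
      rintro t (h | h)
      · exact .inl h.symm
      · exact .inr h.1.symm
    have hadj : t₁ ≠ t₃ → S.IsChild t₁ t₃ ∨ S.IsChild t₃ t₁ := by
      intro hne
      have hr : S.deepest x ≠ S.root := by
        intro hr
        have hp := S.parent_root
        rw [← hr] at hp
        rcases hbag _ h₁ with h | h <;> rcases hbag _ h₃ with h' | h' <;>
          simp only [h, h', hp, ne_eq, not_true_eq_false] at hne
      rcases hbag _ h₁ with rfl | rfl <;> rcases hbag _ h₃ with rfl | rfl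
      · exact absurd rfl hne
      · exact .inl ⟨hr, rfl⟩
      · exact .inr ⟨hr, rfl⟩
      · exact absurd rfl hne
    have hmem : t₂ = t₁ ∨ t₂ = t₃ := by
      by_cases hne : t₁ = t₃
      · subst hne
        rw [(S.isTree.isAcyclic.subsingleton_path t₁ t₁).elim p SimpleGraph.Path.nil] at hp
        exact .inl (by simpa using hp)
      · rcases hadj hne with h | h
        · exact ParentTree.eq_or_eq_of_mem_path_of_isChild h p hp
        · refine (ParentTree.eq_or_eq_of_mem_path_of_isChild h p.reverse ?_).symm
          simpa [SimpleGraph.Path.reverse] using hp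
    rcases hmem with rfl | rfl
    · exact h₁
    · exact h₃

theorem decomposition_tree : S.decomposition.tree = S.graph := rfl

theorem exists_mem_bag_iff {x : V} {t : I} (ht : t ≠ S.root) :
    (∃ q, S.Anc t q ∧ x ∈ S.bag q) ↔ x ∈ S.core t ∨ x ∈ S.below t := by
  constructor
  · rintro ⟨q, hq, rfl | ⟨rfl, hx⟩⟩
    · refine .inr ?_
      have hr : S.deepest x ≠ S.root := by
        intro hr
        rw [hr, S.parent_root] at hq
        exact ht ((ParentTree.anc_iff.1 hq).resolve_right fun h => h.1 rfl).symm
      have hne : S.deepest x ≠ t := by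
        intro he
        have h₁ := hq.depth_le
        have h₂ := S.depth_parent _ hr
        rw [← he] at h₁
        omega
      obtain ⟨u, hu, hux⟩ :=
        (ParentTree.anc_iff.2 (.inr ⟨hr, hq⟩) : S.Anc t (S.deepest x)).exists_child hne
      exact ⟨u, hu, S.mem_region_iff.2 hux⟩
    · by_cases he : S.deepest x = t
      · exact .inl (he ▸ hx)
      · obtain ⟨u, hu, hux⟩ := hq.exists_child he
        exact .inr ⟨u, hu, S.mem_region_iff.2 hux⟩
  · rintro (hx | ⟨u, hu, hx⟩)
    · exact ⟨t, ParentTree.anc_refl t, .inr ⟨S.deepest_of_mem_core hx, hx⟩⟩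
    · exact ⟨_, (hu.anc_parent (S.mem_region_iff.1 hx)).2, S.mem_bag_parent x⟩

theorem side_child {s t : I} (h : S.IsChild s t) :
    S.decomposition.side s t = S.core t ∪ S.below t := by
  ext x
  rw [Set.mem_union, ← S.exists_mem_bag_iff h.1]
  simp only [TreeDecomposition.side, decomposition_tree, Set.mem_iUnion, Set.mem_ofPred_eq,
    exists_prop, ParentTree.reachable_child_iff h]
  rfl

theorem side_parent {s t : I} (h : S.IsChild s t) :
    S.decomposition.side t s = (S.below t)ᶜ := by
  ext x
  have hs : x ∈ S.decomposition.side t s ↔ ∃ q, ¬ S.Anc t q ∧ x ∈ S.bag q := by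
    simp only [TreeDecomposition.side, decomposition_tree, Set.mem_iUnion, Set.mem_ofPred_eq,
      exists_prop]
    rw [Sym2.eq_swap]
    simp only [ParentTree.reachable_parent_iff h]
    rfl
  rw [hs, Set.mem_compl_iff]
  constructor
  · rintro ⟨q, hq, hxq⟩ ⟨u, hu, hx⟩
    obtain ⟨h₁, h₂⟩ := hu.anc_parent (S.mem_region_iff.1 hx)
    rcases hxq with rfl | ⟨rfl, -⟩
    · exact hq h₂
    · exact hq (ParentTree.anc_iff.2 (.inr ⟨h₁, h₂⟩))
  · intro hx
    refine ⟨_, fun hq => ?_, S.mem_bag_parent x⟩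
    rcases (S.exists_mem_bag_iff h.1).1 ⟨_, hq, S.mem_bag_parent x⟩ with hc | hb
    · have he := S.deepest_of_mem_core hc
      rw [he] at hq
      have := hq.depth_le
      have := S.depth_parent t h.1
      omega
    · exact hx hb

theorem adhesion_child {s t : I} (h : S.IsChild s t) : S.decomposition.adhesion s t = S.core t := by
  ext x
  constructor
  · rintro ⟨h₁ | h₁, h₂ | h₂⟩
    · exact absurd (h₂.symm.trans h₁) h.ne
    · exact h₂.2
    · have h₃ := h₁.1 ▸ h₂
      by_cases hs : s = S.root
      · rw [hs, S.parent_root] at h₃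
        exact absurd h₃.symm h.1
      · have := S.depth_parent s hs
        have := h.depth_eq
        rw [h₃] at *
        omega
    · exact h₂.2
  · intro hx
    have he := S.deepest_of_mem_core hx
    exact ⟨.inl (by rw [he, h.2]), .inr ⟨he, hx⟩⟩

theorem adhesion_swap (s t : I) :
    S.decomposition.adhesion s t = S.decomposition.adhesion t s := Set.inter_comm _ _

/-- Every edge of the tree joins some node `t` to its parent; the separator there is the core
of `t`. -/
theorem adhesion_eq {s t : I} (h : S.graph.Adj s t) :
    ∃ q, S.decomposition.adhesion s t = S.core q ∧ s(s, t) = s(S.parent q, q) := by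
  rcases h with h | h
  · exact ⟨t, S.adhesion_child h, by rw [h.2]⟩
  · exact ⟨s, by rw [S.adhesion_swap, S.adhesion_child h], by rw [h.2, Sym2.eq_swap]⟩

theorem finite_bag_inter (t : I) : (S.bag t ∩ U).Finite := by
  have hsub : S.bag t ∩ U ⊆ S.core t ∪ ⋃ s ∈ {s | S.IsChild t s}, S.core s := by
    have hU : ∀ x ∈ U, x ∈ S.core (S.deepest x) := by
      intro x hx
      by_contra hc
      have hr : x ∈ S.region (S.deepest x) := S.mem_region_iff.2 (ParentTree.anc_refl _)
      obtain ⟨s, hs, hxs⟩ := S.cover _ x hr hx hc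
      have := (S.mem_region_iff.1 hxs).depth_le
      have := hs.depth_eq
      omega
    rintro x ⟨rfl | ⟨-, hx⟩, hxU⟩
    · by_cases hr : S.deepest x = S.root
      · refine .inl ?_
        have := hU x hxU
        rw [hr] at this
        rwa [hr, S.parent_root]
      · exact .inr (Set.mem_biUnion (show _ ∈ {s | _} from ⟨hr, rfl⟩) (hU x hxU))
    · exact .inl hx
  exact ((S.core_finite t).union
    ((S.finite_children t).biUnion fun s _ => S.core_finite s)).subset hsub

theorem isComplementaryToStar : S.decomposition.IsComplementaryToStar U where
  locallyFinite t := ParentTree.finite_neighborSet (S.finite_children t)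
  finite_separators s t h := by
    obtain ⟨q, hq, -⟩ := S.adhesion_eq h
    exact hq ▸ S.core_finite q
  disjoint_separators s t s' t' h h' hne := by
    obtain ⟨q, hq, e⟩ := S.adhesion_eq h
    obtain ⟨q', hq', e'⟩ := S.adhesion_eq h'
    rw [hq, hq', Set.disjoint_left]
    intro x hx hx'
    have := (S.deepest_of_mem_core hx).symm.trans (S.deepest_of_mem_core hx')
    exact hne (by rw [e, e', this])
  finite_inter := S.finite_bag_inter

theorem connectedSeparators : S.decomposition.ConnectedSeparators := by
  intro s t h
  obtain ⟨q, hq, -⟩ := S.adhesion_eq h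
  exact hq ▸ S.core_connected q

end RegionTree

/-! ### Rays converging along nested connected sets -/

/-- Along a decreasing sequence of connected sets with empty intersection there is a ray with a
tail in each of them: in `A k ∖ A (k + 1)`, walk along a shortest path inside `A k` to
`A (k + 1)`. -/
theorem exists_ray_of_nested {V : Type u} {G : SimpleGraph V} (A : ℕ → Set V)
    (hA : ∀ n, A (n + 1) ⊆ A n) (hconn : ∀ n, (G.induce (A n)).Connected)
    (hesc : ∀ x, ∃ n, x ∉ A n) : ∃ R : Ray G, ∀ n, R.TailIn (A n) := by
  classical
  have hanti : Antitone A := antitone_nat_of_succ_le hA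
  let m : V → ℕ := fun v => Nat.find (hesc v)
  have hm : ∀ v k, v ∈ A k ↔ k < m v := by
    intro v k
    refine ⟨fun h => ?_, fun h => not_not.1 (Nat.find_min (hesc v) h)⟩
    by_contra hk
    exact Nat.find_spec (hesc v) (hanti (not_lt.1 hk) h)
  let Q : V → ℕ → Prop := fun v n =>
    ∃ u ∈ A (m v), ∃ p : G.Walk v u, (∀ x ∈ p.support, x ∈ A (m v - 1)) ∧ p.length = n
  let d : V → ℕ := fun v => sInf {n | Q v n}
  have step : ∀ v : A 0, ∃ w : A 0, G.Adj v w ∧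
      toLex (m v, OrderDual.toDual (d v)) < toLex (m w, OrderDual.toDual (d w)) := by
    rintro ⟨v, hv⟩
    have hpos : 0 < m v := (hm v 0).1 hv
    have hvk : v ∈ A (m v - 1) := (hm v _).2 (by omega)
    have hne : {n | Q v n}.Nonempty := by
      obtain ⟨⟨u, hu⟩⟩ := (hconn (m v)).nonempty
      obtain ⟨p, hp⟩ := exists_path_within (hconn (m v - 1)).preconnected hvk
        (hanti (Nat.sub_le _ 1) hu)
      exact ⟨_, u, hu, p, hp, rfl⟩
    obtain ⟨u, hu, p, hp, hlen⟩ := Nat.sInf_mem hne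
    cases p with
    | nil => exact absurd ((hm v _).1 hu) (lt_irrefl _)
    | @cons _ w _ h p =>
      have hw : w ∈ A (m v - 1) := hp w (by simp)
      refine ⟨⟨w, hanti (Nat.zero_le _) hw⟩, h, ?_⟩
      rw [Prod.Lex.toLex_lt_toLex]
      rcases lt_or_ge (m v) (m w) with hlt | hge
      · exact .inl hlt
      · have heq : m v = m w := by
          have := (hm w _).1 hw
          omega
        refine .inr ⟨heq, OrderDual.toDual_lt_toDual.2 ?_⟩
        have hQ : Q w p.length :=
          ⟨u, heq ▸ hu, p, fun x hx => heq ▸ hp x (by simp [hx]), rfl⟩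
        have hle : d w ≤ p.length := Nat.sInf_le hQ
        have hdv : p.length + 1 = d v := hlen
        change d w < d v
        omega
  choose f hf using step
  obtain ⟨x₀⟩ := (hconn 0).nonempty
  let w : ℕ → A 0 := fun n => f^[n] x₀
  have hw : ∀ n, w (n + 1) = f (w n) := fun n => Function.iterate_succ_apply' _ _ _
  let μ : ℕ → ℕ ×ₗ ℕᵒᵈ := fun n => toLex (m (w n), OrderDual.toDual (d (w n)))
  have hμ : StrictMono μ := strictMono_nat_of_lt_succ fun n => by
    simp only [μ, hw]
    exact (hf (w n)).2
  have hmono : Monotone fun n => m (w n) := monotone_nat_of_le_succ fun n => by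
    have := (hf (w n)).2
    rw [← hw, Prod.Lex.toLex_lt_toLex] at this
    rcases this with h | h
    · exact h.le
    · exact h.1.le
  have hgrow : ∀ N, ∃ n, N < m (w n) := by
    intro N
    induction N with
    | zero => exact ⟨0, (hm _ _).1 (w 0).2⟩
    | succ N ih =>
      obtain ⟨n, hn⟩ := ih
      by_contra! hno
      -- otherwise `m` is constant from `n` on, and `d` decreases forever
      have hd : ∀ k, d (w (n + k)) + k ≤ d (w n) := by
        intro k
        induction k with
        | zero => exact le_rfl
        | succ k ihk =>
          have h₁ := (hf (w (n + k))).2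
          rw [← hw, Prod.Lex.toLex_lt_toLex] at h₁
          rcases h₁ with h | h
          · have h₂ : m (w n) ≤ m (w (n + k)) := hmono (Nat.le_add_right n k)
            have h₃ := hno (n + k + 1)
            change m (w (n + k)) < m (w (n + k + 1)) at h
            omega
          · have h₂ : d (w (n + k + 1)) < d (w (n + k)) := OrderDual.toDual_lt_toDual.1 h.2
            change d (w (n + k + 1)) + (k + 1) ≤ d (w n)
            omega
      have := hd (d (w n) + 1)
      omega
  refine ⟨⟨fun n => w n, ?_, fun n => ?_⟩, fun N => ?_⟩
  · intro i j hij
    have hij' : w i = w j := Subtype.ext hij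
    exact hμ.injective (by simp only [μ, hij'])
  · rw [hw]
    exact (hf (w n)).1
  · obtain ⟨n, hn⟩ := hgrow N
    exact ⟨n, fun k hk => (hm _ _).2 (lt_of_lt_of_le hn (hmono hk))⟩

/-! ### The position of ends and critical vertex sets -/

section Remainder

variable {V : Type u} {G : SimpleGraph V}

theorem Ray.TailIn.mono {R : Ray G} {A B : Set V} (h : R.TailIn A) (hAB : A ⊆ B) : R.TailIn B :=
  h.imp fun _ hn m hm => hAB (hn m hm)

theorem Ray.TailIn.inter_nonempty {R : Ray G} {A B : Set V} (hA : R.TailIn A) (hB : R.TailIn B) :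
    (A ∩ B).Nonempty := by
  obtain ⟨a, ha⟩ := hA
  obtain ⟨b, hb⟩ := hB
  exact ⟨_, ha (max a b) (le_max_left _ _), hb (max a b) (le_max_right _ _)⟩

theorem Ends.exists_ray (ω : Ends G) : ∃ R : Ray G, R.toEnd = ω := Quotient.exists_rep ω

theorem Ends.TailIn.mono {ω : Ends G} {A B : Set V} (h : ω.TailIn A) (hAB : A ⊆ B) : ω.TailIn B :=
  fun R hR => (h R hR).mono hAB

theorem Ends.TailIn.inter_nonempty {ω : Ends G} {A B : Set V} (hA : ω.TailIn A)
    (hB : ω.TailIn B) : (A ∩ B).Nonempty := by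
  obtain ⟨R, hR⟩ := ω.exists_ray
  exact (hA R hR).inter_nonempty (hB R hR)

theorem Ray.TailIn.toEnd {R : Ray G} {X : Set V} (hX : X.Finite) {C : G.ComponentCompl X}
    (h : R.TailIn (C : Set V)) : R.toEnd.TailIn (C : Set V) := by
  intro R' hR'
  obtain ⟨D, h₁, h₂⟩ := Quotient.exact hR' X hX
  exact h₂.component_eq h ▸ h₁

theorem Ends.exists_tailIn (ω : Ends G) {X : Set V} (hX : X.Finite) :
    ∃ C : G.ComponentCompl X, ω.TailIn (C : Set V) := by
  obtain ⟨R, rfl⟩ := ω.exists_ray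
  obtain ⟨C, hC⟩ := R.exists_tailIn X hX
  exact ⟨C, hC.toEnd hX⟩

/-- `γ` lives in the vertex set `A`: an end does so if its rays have tails in `A`, and a critical
vertex set `X` if `A` contains `X` and all but finitely many of the components of `G - X` with
neighbourhood `X`. An edge of a tree-decomposition is oriented by `γ` towards those of its sides in
which `γ` lives. -/
def LivesIn : Remainder G → Set V → Prop
  | Sum.inl ω, A => ω.TailIn A
  | Sum.inr X, A =>
      X.1 ⊆ A ∧ {C ∈ componentsWithNbhd G X.1 X.1 | ¬ (C : Set V) ⊆ A}.Finite

theorem LivesIn.mono {γ : Remainder G} {A B : Set V} (h : LivesIn γ A) (hAB : A ⊆ B) :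
    LivesIn γ B := by
  rcases γ with ω | X
  · exact Ends.TailIn.mono h hAB
  · exact ⟨h.1.trans hAB, h.2.subset fun C hC => ⟨hC.1, fun h' => hC.2 (h'.trans hAB)⟩⟩

theorem orients_iff {I : Type v} (D : TreeDecomposition G I) (γ : Remainder G) (s t : I) :
    D.Orients γ s t ↔ LivesIn γ (D.side s t) := by
  rcases γ with ω | X <;> exact Iff.rfl

theorem finite_components_not_disjoint {X Y : Set V} (hY : Y.Finite) :
    {C : G.ComponentCompl X | ¬ Disjoint (C : Set V) Y}.Finite := by
  refine (hY.biUnion (t := fun y => {C : G.ComponentCompl X | y ∈ C}) fun y _ =>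
    Set.Subsingleton.finite fun C hC D hD => component_eq_of_mem hC hD).subset ?_
  intro C hC
  obtain ⟨y, h₁, h₂⟩ := Set.not_disjoint_iff.1 hC
  exact Set.mem_biUnion h₂ h₁

end Remainder

namespace RegionTree

variable {V : Type u} {G : SimpleGraph V} {U : Set V} {I : Type v} (S : RegionTree G U I)

theorem exists_depth_bound_of_finite {X : Set V} (hX : X.Finite) :
    ∃ n, ∀ t, S.depth t = n → Disjoint (S.region t) X := by
  choose b hb using S.exists_depth_bound
  obtain ⟨n, hn⟩ := (hX.image b).bddAbove
  refine ⟨n + 1, fun t ht => Set.disjoint_left.2 fun x hx hxX => ?_⟩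
  have h₁ := hb x t hx
  have h₂ : b x ≤ n := hn ⟨x, hxX, rfl⟩
  omega

theorem exists_component_child {s t : I} (h : S.IsChild s t) :
    ∃ C : G.ComponentCompl (S.core s), (C : Set V) = S.region t :=
  exists_component_eq (S.region_connected t) (S.disjoint_core s t h) (S.nbhd_subset s t h)

/-- If `γ` lives in the region of `t` but not in that of any child of `t`, then it lives at the
parent of `t`, because the separators are shifted by one level: the separator between `t` and its
parent is the core of `t`. -/
theorem livesAt_parent {γ : Remainder G} {t : I}
    (h₁ : t ≠ S.root → LivesIn γ (S.core (S.parent t) ∪ S.region t))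
    (h₂ : LivesIn γ (S.below t)ᶜ) : S.decomposition.LivesAt γ (S.parent t) := by
  intro s hs
  rw [orients_iff]
  have hs' : S.IsChild s (S.parent t) ∨ S.IsChild (S.parent t) s := hs
  rcases hs' with hs | hs
  · rw [S.side_child hs]
    have ht : t ≠ S.root := fun ht => hs.1 (by rw [ht, S.parent_root])
    refine (h₁ ht).mono (Set.union_subset_union_right _ fun x hx => ⟨t, ⟨ht, rfl⟩, hx⟩)
  · rw [S.side_parent hs]
    by_cases ht : t = S.root
    · refine h₂.mono (Set.compl_subset_compl.2 fun x hx => ⟨s, ?_, S.below_subset s hx⟩)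
      rwa [ht, S.parent_root, ← ht] at hs
    · by_cases hst : s = t
      · exact hst ▸ h₂
      · refine (h₁ ht).mono fun x hx hxs => ?_
        have hxs := S.below_subset s hxs
        rcases hx with hx | hx
        · exact Set.disjoint_left.1 (S.disjoint_core _ _ hs) hxs hx
        · exact Set.disjoint_left.1 (S.disjoint_siblings _ _ _ hs ⟨ht, rfl⟩ hst) hxs hx

/-! ### Critical vertex sets live at nodes -/

theorem exists_component_subset {X : Crit G} {A : Set V}
    (h : {C ∈ componentsWithNbhd G X.1 X.1 | ¬ (C : Set V) ⊆ A}.Finite) :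
    {C ∈ componentsWithNbhd G X.1 X.1 | (C : Set V) ⊆ A}.Infinite := by
  intro h'
  refine X.2.2 ((h.union h').subset fun C hC => ?_)
  by_cases hA : (C : Set V) ⊆ A
  · exact .inr ⟨hC, hA⟩
  · exact .inl ⟨hC, hA⟩

theorem crit_livesIn_core_union {X : Crit G} {t : I} (ht : t ≠ S.root)
    (h : {C ∈ componentsWithNbhd G X.1 X.1 | ¬ (C : Set V) ⊆ S.region t}.Finite) :
    LivesIn (Sum.inr X) (S.core (S.parent t) ∪ S.region t) := by
  refine ⟨fun x hx => ?_, h.subset fun C hC =>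
    ⟨hC.1, fun h' => hC.2 (h'.trans Set.subset_union_right)⟩⟩
  obtain ⟨C, hC, hCt⟩ := (exists_component_subset h).nonempty
  obtain ⟨-, w, hw, hxw⟩ := hC.symm ▸ hx
  by_cases hxt : x ∈ S.region t
  · exact .inr hxt
  · exact .inl (S.nbhd_subset _ t ⟨ht, rfl⟩ ⟨hxt, w, hCt hw, hxw⟩)

/-- A critical vertex set cannot be separated by a finite set: if it meets the region of a child
of `t`, then almost all its components lie there. -/
theorem crit_finite_of_mem {X : Crit G} {s t : I} (hst : S.IsChild s t) {x : V} (hx : x ∈ X.1)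
    (hxt : x ∈ S.region t) :
    {C ∈ componentsWithNbhd G X.1 X.1 | ¬ (C : Set V) ⊆ S.region t}.Finite := by
  refine (finite_components_not_disjoint (S.core_finite s)).subset ?_
  rintro C ⟨hC, hCt⟩ hdis
  obtain ⟨-, w, hw, hxw⟩ := hC.symm ▸ hx
  refine hCt (subset_of_nbhd_subset (component_connected C).preconnected hdis
    (S.nbhd_subset _ _ hst) hw ?_)
  by_contra hwt
  exact Set.disjoint_left.1 hdis hw (S.nbhd_subset _ _ hst ⟨hwt, x, hxt, hxw.symm⟩)

theorem crit_livesIn_compl_below {X : Crit G} {t : I} (h : ∀ s, S.IsChild t s →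
      ¬ {C ∈ componentsWithNbhd G X.1 X.1 | ¬ (C : Set V) ⊆ S.region s}.Finite) :
    LivesIn (Sum.inr X) (S.below t)ᶜ := by
  have hX : ∀ s, S.IsChild t s → Disjoint (S.region s) X.1 := fun s hs =>
    Set.disjoint_left.2 fun x hx hxX => h s hs (S.crit_finite_of_mem hs hxX hx)
  refine ⟨fun x hx ⟨s, hs, hxs⟩ => Set.disjoint_left.1 (hX s hs) hxs hx, ?_⟩
  refine ((finite_components_not_disjoint (S.core_finite t)).union
    ((S.finite_children t).biUnion
      (t := fun s => {C : G.ComponentCompl X.1 | (C : Set V) = S.region s}) fun s _ => ?_)).subset ?_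
  · exact Set.Subsingleton.finite fun C hC D hD =>
      SimpleGraph.ComponentCompl.coe_inj.1 (Eq.trans hC (Eq.symm hD))
  · rintro C ⟨hC, hCt⟩
    by_cases hdis : Disjoint (C : Set V) (S.core t)
    · obtain ⟨y, hyC, hy⟩ := Set.not_subset.1 hCt
      obtain ⟨s, hs, hys⟩ := not_not.1 hy
      refine .inr (Set.mem_biUnion (show s ∈ {s | _} from hs) ?_)
      exact (subset_of_nbhd_subset (component_connected C).preconnected hdis
        (S.nbhd_subset _ _ hs) hyC hys).antisymm
        (subset_component (S.region_connected s).preconnected (hX s hs) C hys hyC)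
    · exact .inl hdis

theorem crit_not_disjoint {X : Crit G} {t : I}
    (h : {C ∈ componentsWithNbhd G X.1 X.1 | ¬ (C : Set V) ⊆ S.region t}.Finite) :
    ¬ Disjoint (S.region t) X.1 := by
  intro hdis
  refine exists_component_subset h (Set.Subsingleton.finite fun C hC D hD => ?_)
  have key : ∀ C : G.ComponentCompl X.1, (C : Set V) ⊆ S.region t → (C : Set V) = S.region t := by
    intro C hC
    obtain ⟨v, hv⟩ := C.nonempty
    exact hC.antisymm (subset_component (S.region_connected t).preconnected hdis C (hC hv) hv)
  exact SimpleGraph.ComponentCompl.coe_inj.1 ((key C hC.2).trans (key D hD.2).symm)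

theorem crit_livesAt (X : Crit G) : ∃ t, S.decomposition.LivesAt (Sum.inr X) t := by
  obtain ⟨t, h₁, h₂⟩ : ∃ t,
      {C ∈ componentsWithNbhd G X.1 X.1 | ¬ (C : Set V) ⊆ S.region t}.Finite ∧
      ∀ s, S.IsChild t s →
        ¬ {C ∈ componentsWithNbhd G X.1 X.1 | ¬ (C : Set V) ⊆ S.region s}.Finite := by
    by_contra! hno
    have key : ∀ n, ∃ t, S.depth t = n ∧
        {C ∈ componentsWithNbhd G X.1 X.1 | ¬ (C : Set V) ⊆ S.region t}.Finite := by
      intro n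
      induction n with
      | zero => exact ⟨S.root, S.depth_root, by simp [S.region_root]⟩
      | succ n ih =>
        obtain ⟨t, ht, hf⟩ := ih
        obtain ⟨s, hs, hf'⟩ := hno t hf
        exact ⟨s, by rw [hs.depth_eq, ht], hf'⟩
    obtain ⟨n, hn⟩ := S.exists_depth_bound_of_finite X.2.1
    obtain ⟨t, ht, hf⟩ := key n
    exact S.crit_not_disjoint hf (hn t ht)
  exact ⟨_, S.livesAt_parent (fun ht => S.crit_livesIn_core_union ht h₁)
    (S.crit_livesIn_compl_below h₂)⟩

/-! ### Ends live at nodes or correspond to ends of the tree -/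

theorem end_child_or_compl (ω : Ends G) (t : I) :
    (∃ s, S.IsChild t s ∧ ω.TailIn (S.region s)) ∨ ω.TailIn (S.below t)ᶜ := by
  obtain ⟨C, hC⟩ := ω.exists_tailIn (S.core_finite t)
  by_cases h : ∃ s, S.IsChild t s ∧ (C : Set V) = S.region s
  · obtain ⟨s, hs, e⟩ := h
    exact .inl ⟨s, hs, e ▸ hC⟩
  · refine .inr (hC.mono fun x hx => ?_)
    rintro ⟨s, hs, hxs⟩
    obtain ⟨C', hC'⟩ := S.exists_component_child hs
    have hx' : x ∈ C' := by
      rw [← SetLike.mem_coe, hC']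
      exact hxs
    exact h ⟨s, hs, component_eq_of_mem hx hx' ▸ hC'⟩

theorem end_livesAt_parent {ω : Ends G} {t : I} (h₁ : ω.TailIn (S.region t))
    (h₂ : ω.TailIn (S.below t)ᶜ) : S.decomposition.LivesAt (Sum.inl ω) (S.parent t) :=
  S.livesAt_parent (fun _ => Ends.TailIn.mono h₁ Set.subset_union_right) h₂

theorem end_dichotomy (ω : Ends G) :
    (∃ t, ω.TailIn (S.region t) ∧ ω.TailIn (S.below t)ᶜ) ∨
    ∃ c : ℕ → I, c 0 = S.root ∧ (∀ n, S.IsChild (c n) (c (n + 1))) ∧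
      ∀ n, ω.TailIn (S.region (c n)) := by
  by_cases h : ∃ t, ω.TailIn (S.region t) ∧ ω.TailIn (S.below t)ᶜ
  · exact .inl h
  · right
    push Not at h
    have step : ∀ t : {t // ω.TailIn (S.region t)}, ∃ s : {t // ω.TailIn (S.region t)},
        S.IsChild t.1 s.1 := by
      rintro ⟨t, ht⟩
      obtain ⟨s, hs, hω⟩ := (S.end_child_or_compl ω t).resolve_right (h t ht)
      exact ⟨⟨s, hω⟩, hs⟩
    choose f hf using step
    have h₀ : ω.TailIn (S.region S.root) := fun R _ => ⟨0, fun _ _ => S.mem_root _⟩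
    refine ⟨fun n => (f^[n] ⟨S.root, h₀⟩).1, rfl, fun n => ?_, fun n => (f^[n] ⟨S.root, h₀⟩).2⟩
    simp only [Function.iterate_succ_apply']
    exact hf _

theorem exists_disjoint_of_chain {c : ℕ → I} (hc : ∀ n, S.IsChild (c n) (c (n + 1)))
    (h₀ : c 0 = S.root) {X : Set V} (hX : X.Finite) : ∃ n, Disjoint (S.region (c n)) X := by
  obtain ⟨n, hn⟩ := S.exists_depth_bound_of_finite hX
  refine ⟨n, hn _ ?_⟩
  rw [ParentTree.depth_of_chain hc, h₀, S.depth_root, zero_add]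

theorem end_inClosure_of_chain {ω : Ends G} {c : ℕ → I} (h₀ : c 0 = S.root)
    (hc : ∀ n, S.IsChild (c n) (c (n + 1))) (hω : ∀ n, ω.TailIn (S.region (c n))) :
    ω.InClosure U := by
  intro X hX
  obtain ⟨n, hn⟩ := S.exists_disjoint_of_chain hc h₀ hX
  have hn' : Disjoint (S.region (c (n + 1))) X := hn.mono_left (S.region_subset _ _ (hc n))
  obtain ⟨u, hu, huU⟩ := S.region_meets _ _ (hc n)
  have huX := Set.disjoint_left.1 hn' hu
  have hsub := subset_component (S.region_connected _).preconnected hn' (G.componentComplMk huX) hu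
    (G.componentComplMk_mem huX)
  exact ⟨_, (hω (n + 1)).mono hsub, u, hsub hu, huU⟩

theorem end_not_tailIn_compl_below {ω : Ends G} (hω : ω.InClosure U) {t : I}
    (h₁ : ω.TailIn (S.region t)) : ¬ ω.TailIn (S.below t)ᶜ := by
  intro h₂
  have hfin : (nbhd G (S.region t)).Finite := by
    by_cases ht : t = S.root
    · have : nbhd G (S.region t) = ∅ := by
        rw [ht, S.region_root]
        exact Set.eq_empty_of_forall_notMem fun x hx => hx.1 (Set.mem_univ x)
      rw [this]
      exact Set.finite_empty
    · exact (S.core_finite _).subset (S.nbhd_subset _ t ⟨ht, rfl⟩)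
  -- the component in which `ω` lives lies inside the region of `t` and meets `U`
  obtain ⟨C, hC, u, huC, huU⟩ := hω _ ((S.core_finite t).union hfin)
  obtain ⟨x, hxC, hxt⟩ := hC.inter_nonempty h₁
  have hCt : (C : Set V) ⊆ S.region t := subset_of_nbhd_subset
    (component_connected C).preconnected C.disjoint_right.symm Set.subset_union_right hxC hxt
  have hCcore : Disjoint (C : Set V) (S.core t) :=
    C.disjoint_right.symm.mono_right Set.subset_union_left
  obtain ⟨s, hs, hus⟩ := S.cover t u (hCt huC) huU (Set.disjoint_left.1 hCcore huC)
  have hCs : (C : Set V) ⊆ S.region s := subset_of_nbhd_subset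
    (component_connected C).preconnected hCcore (S.nbhd_subset _ _ hs) huC hus
  obtain ⟨y, hy, hy'⟩ := hC.inter_nonempty h₂
  exact hy' ⟨s, hs, hCs hy⟩

theorem end_correspondsTo {ω : Ends G} {c : ℕ → I}
    (hc : ∀ n, S.IsChild (c n) (c (n + 1))) (hω : ∀ n, ω.TailIn (S.region (c n))) :
    S.decomposition.CorrespondsTo (Sum.inl ω) (ParentTree.rayOfChain c hc).toEnd := by
  refine ⟨ParentTree.rayOfChain c hc, rfl, fun n => ?_⟩
  rw [orients_iff]
  change ω.TailIn (S.decomposition.side (c n) (c (n + 1)))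
  rw [S.side_child (hc n)]
  exact (hω (n + 2)).mono fun x hx => .inr ⟨_, hc (n + 1), hx⟩

theorem end_eq_of_chain {ω ω' : Ends G} {c : ℕ → I} (h₀ : c 0 = S.root)
    (hc : ∀ n, S.IsChild (c n) (c (n + 1))) (hω : ∀ n, ω.TailIn (S.region (c n)))
    (hω' : ∀ n, ω'.TailIn (S.region (c n))) : ω = ω' := by
  obtain ⟨R, rfl⟩ := ω.exists_ray
  obtain ⟨R', rfl⟩ := ω'.exists_ray
  refine Quotient.sound fun X hX => ?_
  obtain ⟨n, hn⟩ := S.exists_disjoint_of_chain hc h₀ hX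
  obtain ⟨⟨v, hv⟩⟩ := (S.region_connected (c n)).nonempty
  have hvX := Set.disjoint_left.1 hn hv
  have hsub := subset_component (S.region_connected _).preconnected hn (G.componentComplMk hvX) hv
    (G.componentComplMk_mem hvX)
  exact ⟨_, (hω n R rfl).mono hsub, (hω' n R' rfl).mono hsub⟩

/-- Every descending sequence of nodes is followed by an end of `G`. -/
theorem exists_end_of_chain {c : ℕ → I} (hc : ∀ n, S.IsChild (c n) (c (n + 1))) :
    ∃ ω : Ends G, ∀ n, ω.TailIn (S.region (c (n + 1))) := by
  obtain ⟨R, hR⟩ := exists_ray_of_nested (fun n => S.region (c n))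
    (fun n => S.region_subset _ _ (hc n)) (fun n => S.region_connected _) (fun x => by
      obtain ⟨n, hn⟩ := S.exists_depth_bound x
      refine ⟨n + 1, fun hx => ?_⟩
      have := hn _ hx
      have := ParentTree.depth_of_chain hc (n + 1)
      omega)
  refine ⟨R.toEnd, fun n => ?_⟩
  obtain ⟨C, hC⟩ := S.exists_component_child (hc n)
  rw [← hC]
  refine Ray.TailIn.toEnd (S.core_finite _) ?_
  rw [hC]
  exact hR (n + 1)

/-! ### Tameness and display -/

theorem isTame_of_finite {X : Set V} (hX : X.Finite) {p : Set V × Set V} (hp : p.1 ∩ p.2 = X)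
    (𝒞 : Set (G.ComponentCompl X)) (h : p = sepOf 𝒞) (hfin : 𝒞.Finite ∨ 𝒞ᶜ.Finite) :
    IsTame G p := by
  subst hp
  refine ⟨hX, 𝒞, h, fun Y _ hY => ?_⟩
  rcases hfin with hfin | hfin
  · exact hY.1 (hfin.subset Set.inter_subset_left)
  · exact hY.2 (hfin.subset Set.inter_subset_left)

theorem isTame_sep {s t : I} (h : S.graph.Adj s t) : IsTame G (S.decomposition.sep s t) := by
  have key : ∀ t, ∃ 𝒞 : Set (G.ComponentCompl (S.core t)), 𝒞.Finite ∧
      vertsOf 𝒞 = S.below t ∧ vertsOf 𝒞ᶜ = (S.core t ∪ S.below t)ᶜ := by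
    intro t
    refine ⟨{C | ∃ s, S.IsChild t s ∧ (C : Set V) = S.region s}, ?_, ?_, ?_⟩
    · refine ((S.finite_children t).biUnion
        (t := fun s => {C : G.ComponentCompl (S.core t) | (C : Set V) = S.region s})
        fun s _ => Set.Subsingleton.finite fun C hC D hD =>
          SimpleGraph.ComponentCompl.coe_inj.1 (Eq.trans hC (Eq.symm hD))).subset ?_
      rintro C ⟨s, hs, hC⟩
      exact Set.mem_biUnion (show s ∈ {s | _} from hs) hC
    · ext x
      simp only [vertsOf, Set.mem_iUnion, exists_prop]
      constructor
      · rintro ⟨C, ⟨s, hs, hC⟩, hx⟩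
        exact ⟨s, hs, hC ▸ hx⟩
      · rintro ⟨s, hs, hx⟩
        obtain ⟨C, hC⟩ := S.exists_component_child hs
        exact ⟨C, ⟨s, hs, hC⟩, hC ▸ hx⟩
    · ext x
      simp only [vertsOf, Set.mem_iUnion, exists_prop]
      constructor
      · rintro ⟨C, hC, hx⟩ (hx' | ⟨s, hs, hxs⟩)
        · exact SimpleGraph.ComponentCompl.notMem_of_mem hx hx'
        · obtain ⟨C', hC'⟩ := S.exists_component_child hs
          have hx' : x ∈ C' := by
            rw [← SetLike.mem_coe, hC']
            exact hxs
          exact hC ⟨s, hs, component_eq_of_mem hx hx' ▸ hC'⟩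
      · intro hx
        have hxc : x ∉ S.core t := fun h => hx (.inl h)
        refine ⟨G.componentComplMk hxc, ?_, G.componentComplMk_mem hxc⟩
        rintro ⟨s, hs, hC⟩
        refine hx (.inr ⟨s, hs, ?_⟩)
        rw [← hC]
        exact G.componentComplMk_mem hxc
  have hinter : ∀ t, (S.below t)ᶜ ∩ (S.core t ∪ S.below t) = S.core t := by
    intro t
    ext x
    have : x ∈ S.core t → x ∉ S.below t := fun h =>
      Set.disjoint_left.1 (S.disjoint_core_below t) h
    simp only [Set.mem_inter_iff, Set.mem_compl_iff, Set.mem_union]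
    tauto
  rcases h with h | h
  · obtain ⟨𝒞, hfin, h₁, -⟩ := key t
    have e : S.decomposition.sep s t = ((S.below t)ᶜ, S.core t ∪ S.below t) := by
      rw [TreeDecomposition.sep, S.side_child h, S.side_parent h]
    rw [e]
    exact isTame_of_finite (S.core_finite t) (hinter t) 𝒞 (by rw [sepOf, h₁]) (.inl hfin)
  · obtain ⟨𝒞, hfin, -, h₂⟩ := key s
    have e : S.decomposition.sep s t = (S.core s ∪ S.below s, (S.below s)ᶜ) := by
      rw [TreeDecomposition.sep, S.side_child h, S.side_parent h]
    rw [e]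
    refine isTame_of_finite (S.core_finite s) (by rw [Set.inter_comm]; exact hinter s) 𝒞ᶜ ?_
      (.inr (by rwa [compl_compl]))
    rw [sepOf, h₂, compl_compl]
    congr 1
    ext x
    have : x ∈ S.core s → x ∉ S.below s := fun h =>
      Set.disjoint_left.1 (S.disjoint_core_below s) h
    simp only [Set.mem_compl_iff, Set.mem_union]
    tauto

theorem displays (hb : boundary G U ⊆ Set.range Sum.inl) :
    S.decomposition.Displays S.root (boundary G U) := by
  have hex : ∀ γ : Remainder G, ∃ x : Ends S.decomposition.tree ⊕ I, S.decomposition.Sends γ x ∧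
      (γ ∈ boundary G U → ∃ (c : ℕ → I) (hc : ∀ n, S.IsChild (c n) (c (n + 1))),
        c 0 = S.root ∧ x = Sum.inl (ParentTree.rayOfChain c hc).toEnd ∧
        ∀ n, LivesIn γ (S.region (c n))) ∧
      (γ ∉ boundary G U → ∃ t, x = Sum.inr t) := by
    rintro (ω | X)
    · rcases S.end_dichotomy ω with ⟨t, h₁, h₂⟩ | ⟨c, h₀, hc, hω⟩
      · exact ⟨Sum.inr _, S.end_livesAt_parent h₁ h₂,
          fun hω => absurd h₂ (S.end_not_tailIn_compl_below hω h₁), fun _ => ⟨_, rfl⟩⟩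
      · exact ⟨Sum.inl _, S.end_correspondsTo hc hω, fun _ => ⟨c, hc, h₀, rfl, hω⟩,
          fun hn => absurd (S.end_inClosure_of_chain h₀ hc hω) hn⟩
    · obtain ⟨t, ht⟩ := S.crit_livesAt X
      refine ⟨Sum.inr t, ht, fun hX => ?_, fun _ => ⟨t, rfl⟩⟩
      obtain ⟨ω, hω⟩ := hb hX
      exact absurd hω Sum.inl_ne_inr
  choose σ hσ hin hout using hex
  have hfin : ∀ t, (S.decomposition.tree.neighborSet t).Finite :=
    S.isComplementaryToStar.locallyFinite
  refine ⟨fun s t h => S.isTame_sep h, σ, hσ, ⟨?_, ?_, ?_⟩, ?_, ?_, ?_⟩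
  · rintro γ ⟨hγ, -⟩
    obtain ⟨c, hc, -, h, -⟩ := hin γ hγ
    exact ⟨_, h.symm⟩
  · rintro _ ⟨hγ, ω, rfl⟩ _ ⟨hγ', ω', rfl⟩ he
    obtain ⟨c, hc, h₀, h, hω⟩ := hin _ hγ
    obtain ⟨c', hc', h₀', h', hω'⟩ := hin _ hγ'
    rw [h, h'] at he
    have hcc : c = c' := funext fun n =>
      ParentTree.chain_eq_of_toEnd_eq hc hc' (h₀.trans h₀'.symm) (Sum.inl_injective he) n
    subst hcc
    rw [S.end_eq_of_chain h₀ hc hω hω']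
  · rintro _ ⟨η, rfl⟩
    obtain ⟨W, rfl⟩ := η.exists_ray
    obtain ⟨N, hN⟩ := ParentTree.exists_descending_tail W
    obtain ⟨ω, hω⟩ := S.exists_end_of_chain (c := fun n => W.vert (N + n))
      (fun n => hN (N + n) (Nat.le_add_right _ _))
    have hdep : ∀ n, S.depth (W.vert (N + n)) = S.depth (W.vert N) + n := fun n =>
      ParentTree.depth_of_chain (c := fun n => W.vert (N + n))
        (fun n => hN (N + n) (Nat.le_add_right _ _)) n
    rcases S.end_dichotomy ω with ⟨t, h₁, h₂⟩ | ⟨c, h₀, hc, hωc⟩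
    · -- `ω` cannot stop at `t`, since it lives in regions of larger depth
      obtain ⟨x, hx, hx'⟩ := h₁.inter_nonempty (hω (S.depth t))
      have hd := hdep (S.depth t + 1)
      rw [S.mem_region_iff] at hx hx'
      have hanc : S.Anc t (W.vert (N + (S.depth t + 1))) := by
        rcases ParentTree.anc_total hx hx' with h | h
        · exact h
        · have := h.depth_le
          omega
      have hne : W.vert (N + (S.depth t + 1)) ≠ t := fun h => by
        rw [h] at hd
        omega
      obtain ⟨u, hu, huW⟩ := hanc.exists_child hne
      obtain ⟨y, hy, hy'⟩ := (hω (S.depth t)).inter_nonempty h₂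
      exact absurd ⟨u, hu, S.region_mono huW hy⟩ hy'
    · have hγ : Sum.inl ω ∈ boundary G U := S.end_inClosure_of_chain h₀ hc hωc
      refine ⟨Sum.inl ω, ⟨hγ, ω, rfl⟩, ?_⟩
      obtain ⟨c', hc', h₀', h', hω'⟩ := hin _ hγ
      rw [h']
      refine congrArg Sum.inl (Ray.toEnd_eq_of_tail_eq (S.depth (W.vert N) + 1) (N + 1)
        fun n => ?_)
      obtain ⟨x, hx, hx'⟩ :=
        Ends.TailIn.inter_nonempty (hω' (S.depth (W.vert N) + 1 + n)) (hω n)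
      have he := S.eq_of_mem_of_depth hx hx' (by
        rw [hdep, ParentTree.depth_of_chain hc', h₀', S.depth_root]
        omega)
      rw [show N + 1 + n = N + (n + 1) by omega]
      exact he
  · have h₁ : boundary G U ∩ Set.range Sum.inr = ∅ := by
      refine Set.eq_empty_of_forall_notMem ?_
      rintro _ ⟨hγ, X, rfl⟩
      obtain ⟨ω, hω⟩ := hb hγ
      exact Sum.inl_ne_inr hω
    have h₂ : {t | (S.decomposition.tree.neighborSet t).Infinite} = ∅ :=
      Set.eq_empty_of_forall_notMem fun t ht => ht (hfin t)
    rw [h₁, h₂, Set.image_empty]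
    exact Set.bijOn_empty σ
  · intro X hX
    obtain ⟨ω, hω⟩ := hb hX
    exact absurd hω Sum.inl_ne_inr
  · intro γ hγ
    obtain ⟨t, ht⟩ := hout γ hγ
    exact ⟨t, hfin t, ht⟩

end RegionTree

/-! ### Constructing a region tree in the absence of a star -/

section Construction

variable {V : Type u} {G : SimpleGraph V} {U : Set V}

/-- In the absence of a star, a connected set `D` with finite neighbourhood contains a finite
connected set `Y` separating its neighbourhood from all vertices of `U` in `D ∖ Y`: such a vertex
lies in a component of `G - Y` inside `D`. -/
theorem exists_core (h : ¬ HasStarAttachedTo G U) {D : Set V} (hD : (G.induce D).Connected)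
    (hN : (nbhd G D).Finite) :
    ∃ Y ⊆ D, Y.Finite ∧ (G.induce Y).Connected ∧
      ∀ C : G.ComponentCompl Y, ∀ u ∈ C, u ∈ U → u ∈ D → (C : Set V) ⊆ D := by
  obtain ⟨S, hS, hSN, hsep⟩ := exists_separating_set h hN
  obtain ⟨Y, hSY, hYD, hY, hYc⟩ := exists_finite_connected_superset hD
    (hS.subset Set.inter_subset_left) (Set.inter_subset_right : S ∩ D ⊆ D)
  refine ⟨Y, hYD, hY, hYc, fun C u huC huU huD => ?_⟩
  have huS : u ∉ S := fun hu => SimpleGraph.ComponentCompl.notMem_of_mem huC (hSY ⟨hu, huD⟩)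
  let K := G.componentComplMk huS
  have huK : u ∈ K := G.componentComplMk_mem huS
  have hKN : ∀ n ∈ K, n ∉ nbhd G D := fun n hn hnN =>
    (hsep K ⟨n, hn, hnN⟩ u huK huU).1 huD
  have hsub : (C : Set V) ⊆ D ∩ K := by
    refine component_subset_of_closed C huC ⟨huD, huK⟩ ?_
    rintro a - ⟨haD, haK⟩ b hbC hab
    have hbS : b ∉ S := fun hb => by
      by_cases hbD : b ∈ D
      · exact SimpleGraph.ComponentCompl.notMem_of_mem hbC (hSY ⟨hb, hbD⟩)
      · exact Set.disjoint_left.1 hSN hb ⟨hbD, a, haD, hab.symm⟩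
    have hbK : b ∈ K := SimpleGraph.ComponentCompl.mem_of_adj a b haK hbS hab
    refine ⟨?_, hbK⟩
    by_contra hbD
    exact hKN b hbK ⟨hbD, a, haD, hab.symm⟩
  exact hsub.trans Set.inter_subset_left

/-- `D'` is the vertex set of a component of `G - core D` that is contained in `D` and meets `U`. -/
def IsSubregion (G : SimpleGraph V) (U : Set V) (core : Set V → Set V) (D D' : Set V) : Prop :=
  (∃ C : G.ComponentCompl (core D), (C : Set V) = D') ∧ D' ⊆ D ∧ (D' ∩ U).Nonempty

/-- The regions of depth `n`, obtained from the whole vertex set by passing to subregions `n`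
times. -/
def level (G : SimpleGraph V) (U : Set V) (core : Set V → Set V) : ℕ → Set (Set V)
  | 0 => {Set.univ}
  | n + 1 => {D' | ∃ D ∈ level G U core n, IsSubregion G U core D D'}

theorem level_eq_of_mem {core : Set V → Set V} {n : ℕ} {D₁ D₂ : Set V} {x : V}
    (h₁ : D₁ ∈ level G U core n) (h₂ : D₂ ∈ level G U core n) (hx₁ : x ∈ D₁) (hx₂ : x ∈ D₂) :
    D₁ = D₂ := by
  induction n generalizing D₁ D₂ with
  | zero => exact Eq.trans h₁ (Eq.symm h₂)
  | succ n ih =>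
    obtain ⟨E₁, hE₁, ⟨C₁, rfl⟩, hs₁, -⟩ := h₁
    obtain ⟨E₂, hE₂, ⟨C₂, rfl⟩, hs₂, -⟩ := h₂
    obtain rfl := ih hE₁ hE₂ (hs₁ hx₁) (hs₂ hx₂)
    rw [component_eq_of_mem hx₁ hx₂]

theorem exists_regionTree (hG : G.Connected) (h : ¬ HasStarAttachedTo G U) :
    ∃ I : Type u, Nonempty (RegionTree G U I) := by
  classical
  have hcore : ∀ D : Set V, ∃ Y : Set V, (G.induce D).Connected → (nbhd G D).Finite →
      Y ⊆ D ∧ Y.Finite ∧ (G.induce Y).Connected ∧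
      ∀ C : G.ComponentCompl Y, ∀ u ∈ C, u ∈ U → u ∈ D → (C : Set V) ⊆ D := by
    intro D
    by_cases hD : (G.induce D).Connected ∧ (nbhd G D).Finite
    · obtain ⟨Y, hY⟩ := exists_core h hD.1 hD.2
      exact ⟨Y, fun _ _ => hY⟩
    · exact ⟨∅, fun h₁ h₂ => absurd ⟨h₁, h₂⟩ hD⟩
  choose core hcore using hcore
  have hgood : ∀ n, ∀ D ∈ level G U core n, (G.induce D).Connected ∧ (nbhd G D).Finite := by
    intro n
    induction n with
    | zero =>
      rintro _ rfl
      refine ⟨(SimpleGraph.induceUnivIso G).connected_iff.2 hG, ?_⟩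
      rw [Set.eq_empty_of_forall_notMem (s := nbhd G Set.univ) fun x hx => hx.1 (Set.mem_univ x)]
      exact Set.finite_empty
    | succ n ih =>
      rintro _ ⟨D, hD, ⟨C, rfl⟩, -, -⟩
      obtain ⟨h₁, h₂⟩ := ih D hD
      exact ⟨component_connected C, (hcore D h₁ h₂).2.1.subset (component_nbhd_subset C)⟩
  let I := {p : ℕ × Set V // p.2 ∈ level G U core p.1}
  let root : I := ⟨(0, Set.univ), rfl⟩
  have hroot : ∀ t : I, t.1.1 = 0 → t = root := by
    rintro ⟨⟨n, D⟩, hD⟩ rfl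
    obtain rfl : D = Set.univ := hD
    rfl
  have hparent : ∀ t : I, ∃ p : I, (t = root → p = root) ∧
      (t ≠ root → p.1.1 + 1 = t.1.1 ∧ IsSubregion G U core p.1.2 t.1.2) := by
    intro t
    by_cases ht : t = root
    · exact ⟨root, fun _ => rfl, fun h => absurd ht h⟩
    · obtain ⟨⟨n, D⟩, hD⟩ := t
      cases n with
      | zero => exact absurd (hroot _ rfl) ht
      | succ n =>
        obtain ⟨E, hE, hED⟩ := hD
        exact ⟨⟨(n, E), hE⟩, fun h => absurd h ht, fun _ => ⟨rfl, hED⟩⟩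
  choose parent hp₀ hp using hparent
  let T : ParentTree I :=
    { root := root
      parent := parent
      depth := fun t => t.1.1
      parent_root := hp₀ root rfl
      depth_root := rfl
      depth_parent := fun t ht => (hp t ht).1 }
  have hsub : ∀ s t : I, T.IsChild s t → t.1.1 = s.1.1 + 1 ∧ IsSubregion G U core s.1.2 t.1.2 := by
    rintro s t ⟨ht, rfl⟩
    exact ⟨(hp t ht).1.symm, (hp t ht).2⟩
  have hgood' : ∀ t : I, (G.induce t.1.2).Connected ∧ (nbhd G t.1.2).Finite := fun t =>
    hgood _ _ t.2
  have hcore' := fun t : I => hcore t.1.2 (hgood' t).1 (hgood' t).2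
  refine ⟨I, ⟨{ T with
    region := fun t => t.1.2
    core := fun t => core t.1.2
    region_root := rfl
    region_connected := fun t => (hgood' t).1
    core_subset := fun t => (hcore' t).1
    core_finite := fun t => (hcore' t).2.1
    core_connected := fun t => (hcore' t).2.2.1
    region_subset := fun s t hst => (hsub s t hst).2.2.1
    nbhd_subset := ?_
    disjoint_core := ?_
    disjoint_siblings := ?_
    finite_children := ?_
    region_meets := fun s t hst => (hsub s t hst).2.2.2
    cover := ?_ }⟩⟩
  · intro s t hst
    obtain ⟨-, ⟨C, hC⟩, -⟩ := hsub s t hst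
    rw [← hC]
    exact component_nbhd_subset C
  · intro s t hst
    obtain ⟨-, ⟨C, hC⟩, -⟩ := hsub s t hst
    rw [← hC]
    exact C.disjoint_right.symm
  · intro s t t' hst hst' hne
    refine Set.disjoint_left.2 fun x hx hx' => hne (Subtype.ext (Prod.ext ?_ ?_))
    · rw [(hsub s t hst).1, (hsub s t' hst').1]
    · have ht := t.2
      have ht' := t'.2
      rw [(hsub s t hst).1] at ht
      rw [(hsub s t' hst').1] at ht'
      exact level_eq_of_mem ht ht' hx hx'
  · intro s
    refine Set.Finite.of_finite_image (f := fun t : I => t.1.2) ?_ ?_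
    · refine ((finite_components_meeting hG h (hcore' s).2.1).image
        fun C : G.ComponentCompl (core s.1.2) => (C : Set V)).subset ?_
      rintro _ ⟨t, hst, rfl⟩
      obtain ⟨-, ⟨C, hC⟩, -, hU⟩ := hsub s t hst
      exact ⟨C, show ((C : Set V) ∩ U).Nonempty by rwa [hC], hC⟩
    · intro t hst t' hst' he
      refine Subtype.ext (Prod.ext ?_ he)
      rw [(hsub s t hst).1, (hsub s t' hst').1]
  · intro s u hu huU huc
    have huC := G.componentComplMk_mem huc
    have hCs := (hcore' s).2.2.2 _ u huC huU hu
    have hC : IsSubregion G U core s.1.2 (G.componentComplMk huc : Set V) :=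
      ⟨⟨_, rfl⟩, hCs, u, huC, huU⟩
    let t : I := ⟨(s.1.1 + 1, (G.componentComplMk huc : Set V)), s.1.2, s.2, hC⟩
    have ht : t ≠ root := fun e => by
      have := congrArg (fun t : I => t.1.1) e
      simp [t, root] at this
    refine ⟨t, ⟨ht, ?_⟩, huC⟩
    obtain ⟨h₁, h₂⟩ := hp t ht
    have h₃ : (parent t).1.1 = s.1.1 := Nat.succ_injective h₁
    have h₄ := (parent t).2
    rw [h₃] at h₄
    exact Subtype.ext (Prod.ext h₃ (level_eq_of_mem h₄ s.2 (h₂.2.1 huC) hu))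

end Construction

/-! ### Stars exclude the tree-decomposition -/

/-- Only finitely many parts contain the centre `c` of a star, as the separators are disjoint and
the tree is locally finite. The finitely many finite separators around these parts avoid `c`, but
all paths of the star to leaves outside these parts have to meet them. -/
theorem not_hasStarAttachedTo {V : Type u} {G : SimpleGraph V} {U : Set V} {I : Type v}
    (D : TreeDecomposition G I) (hD : D.IsComplementaryToStar U) : ¬ HasStarAttachedTo G U := by
  rintro ⟨c, L, P, hL, hLU, hcL, hP⟩
  obtain ⟨t, ht⟩ := D.exists_mem c
  let A : Set I := {s | c ∈ D.part s}
  have hA : A.Finite := by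
    refine ((hD.locallyFinite t).union (Set.finite_singleton t)).subset fun s hs => ?_
    obtain ⟨p, hp, -⟩ := D.isTree.existsUnique_path t s
    cases p with
    | nil => exact .inr rfl
    | @cons _ a _ hta p =>
      cases p with
      | nil => exact .inl hta
      | @cons _ b _ hab p =>
        -- three parts along a path give two distinct separators containing `c`
        exfalso
        have hmem : ∀ q ∈ (SimpleGraph.Walk.cons hta (.cons hab p)).support, c ∈ D.part q :=
          fun q hq => D.inter_subset t q s ⟨_, hp⟩ hq ⟨ht, hs⟩
        have ha : c ∈ D.part a := hmem a (by simp)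
        have hb : c ∈ D.part b := hmem b (by simp)
        have htb : t ≠ b := by
          rintro rfl
          simp [SimpleGraph.Walk.cons_isPath_iff] at hp
        refine Set.disjoint_left.1 (hD.disjoint_separators t a a b hta hab ?_) ⟨ht, ha⟩ ⟨ha, hb⟩
        rw [Ne, Sym2.eq_iff]
        rintro (⟨rfl, -⟩ | ⟨h, -⟩)
        · exact hta.ne rfl
        · exact htb h
  let Z : Set V := ⋃ s ∈ A, ⋃ q ∈ {q | D.tree.Adj s q ∧ q ∉ A}, D.adhesion s q
  have hZ : Z.Finite := by
    refine hA.biUnion fun s _ => ((hD.locallyFinite s).subset fun q hq => hq.1).biUnion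
      fun q hq => hD.finite_separators s q hq.1
  have hcZ : c ∉ Z := by
    simp only [Z, Set.mem_iUnion, not_exists]
    intro s _ q hq hc
    exact hq.2 hc.2
  let W : Set V := ⋃ s ∈ A, D.part s
  have hexit : ∀ x y, G.Adj x y → x ∈ W → y ∉ W → x ∈ Z := by
    intro x y hxy hx hy
    simp only [W, Set.mem_iUnion, exists_prop] at hx hy
    obtain ⟨s, hs, hxs⟩ := hx
    obtain ⟨q, hxq, hyq⟩ := D.exists_edge x y hxy
    have hqA : q ∉ A := fun hq => hy ⟨q, hq, hyq⟩
    obtain ⟨p, hp, -⟩ := D.isTree.existsUnique_path s q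
    obtain ⟨d, hd, h₁, h₂⟩ := p.exists_boundary_dart A hs hqA
    have hmem : ∀ r ∈ p.support, x ∈ D.part r := fun r hr =>
      D.inter_subset s r q ⟨p, hp⟩ hr ⟨hxs, hxq⟩
    refine Set.mem_biUnion h₁ (Set.mem_biUnion (show d.snd ∈ {q | _} from ⟨d.adj, h₂⟩) ⟨?_, ?_⟩)
    · exact hmem _ (p.dart_fst_mem_support_of_mem_darts hd)
    · exact hmem _ (p.dart_snd_mem_support_of_mem_darts hd)
  have hLW : (L \ W).Infinite := by
    have hWU : (W ∩ U).Finite := by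
      refine (hA.biUnion fun s _ => hD.finite_inter s).subset ?_
      rintro x ⟨hx, hxU⟩
      simp only [W, Set.mem_iUnion, exists_prop] at hx
      obtain ⟨s, hs, hxs⟩ := hx
      exact Set.mem_biUnion hs ⟨hxs, hxU⟩
    refine fun hfin => hL ((hfin.union hWU).subset fun x hx => ?_)
    by_cases hxW : x ∈ W
    · exact .inr ⟨hxW, hLU hx⟩
    · exact .inl ⟨hx, hxW⟩
  have key : ∀ l : ↥(L \ W), ∃ z ∈ Z, z ∈ (P ⟨l, l.2.1⟩ : G.Walk c l).support := by
    rintro ⟨l, hl, hlW⟩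
    obtain ⟨d, hd, h₁, h₂⟩ := (P ⟨l, hl⟩ : G.Walk c l).exists_boundary_dart W
      (Set.mem_biUnion (show t ∈ A from ht) ht) hlW
    exact ⟨_, hexit _ _ d.adj h₁ h₂, SimpleGraph.Walk.dart_fst_mem_support_of_mem_darts _ hd⟩
  choose z hz hzP using key
  have hinj : Function.Injective z := by
    intro l l' he
    by_contra hne
    have := hP ⟨l, l.2.1⟩ ⟨l', l'.2.1⟩ (fun e => hne (Subtype.ext (Subtype.mk.inj e))) (z l)
      (hzP l) (he ▸ hzP l')
    exact hcZ (this ▸ hz l)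
  have : Infinite ↥(L \ W) := hLW.to_subtype
  exact (Set.infinite_range_of_injective hinj) (hZ.subset (by rintro _ ⟨l, rfl⟩; exact hz l))

end StarComb

theorem theorem7 {V : Type u} (G : SimpleGraph V) (hG : G.Connected) (U : Set V) :
    ((StarComb.HasStarAttachedTo G U ∨
        ∃ (I : Type u) (D : StarComb.TreeDecomposition G I), D.IsComplementaryToStar U) ∧
      ¬ (StarComb.HasStarAttachedTo G U ∧
        ∃ (I : Type u) (D : StarComb.TreeDecomposition G I), D.IsComplementaryToStar U)) ∧
    ((∃ (I : Type u) (D : StarComb.TreeDecomposition G I), D.IsComplementaryToStar U) →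
      StarComb.boundary G U ⊆ Set.range Sum.inl ∧
      ∃ (I : Type u) (D : StarComb.TreeDecomposition G I) (r : I),
        D.IsComplementaryToStar U ∧ D.ConnectedSeparators ∧
        D.Displays r (StarComb.boundary G U)) := by
  refine ⟨⟨?_, ?_⟩, ?_⟩
  · by_cases h : StarComb.HasStarAttachedTo G U
    · exact .inl h
    · obtain ⟨I, ⟨S⟩⟩ := StarComb.exists_regionTree hG h
      exact .inr ⟨I, S.decomposition, S.isComplementaryToStar⟩
  · rintro ⟨h, I, D, hD⟩
    exact StarComb.not_hasStarAttachedTo D hD h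
  · rintro ⟨J, D, hD⟩
    have h := StarComb.not_hasStarAttachedTo D hD
    have hb := StarComb.boundary_subset_ends hG h
    obtain ⟨I, ⟨S⟩⟩ := StarComb.exists_regionTree hG h
    exact ⟨hb, I, S.decomposition, S.root, S.isComplementaryToStar, S.connectedSeparators,
      S.displays hb⟩
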